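/- **Setting.** Let $N=s_0+s_1+\dots+s_d$ with $s_0\ge s_1\ge\dots\ge s_d$, $s_0\ge 1$, and let $B$ be a real $N\times N$ matrix, written in blocks of sizes $s_0,\dots,s_d$, whose only nonzero blocks are the blocks $B_k$ ($1\le k\le d$) in positions $(k-1,k)$, of size $s_{k-1}\times s_k$ and rank $s_k$. Put $F(\tau)=\exp(-\tau B^T)$ and equip $\mathbb R^{N+1}\ni z=(x,t)$ with Lebesgue measure $|\cdot|$ and the group law $(x,t)\circ(y,\tau)=(y+F(\tau)x,\,t+\tau)$. For $z=(x,t)\neq 0$ let $\|z\|$ be the unique $\rho>0$ with $\sum_i x_i^2\rho^{-2a_i}+t^2\rho^{-4}=1$, where $a_i=2k+1$ if $x_i$ belongs to the $k$-th block ($0\le k\le d$); $\|0\|=0$. Let $d(z,\xi)=\|\xi^{-1}\circ z\|+\|z^{-1}\circ\xi\|$ and $B(z,r)=\{w: d(z,w)<r\}$. Fix $0<c_1\le C_1$ and $\theta\in(0,1)$. A *dyadic grid* $\mathscr U$ is a system of measurable sets (cubes) $\mathscr U_k^\alpha$ with points $z_k^\alpha$ ($k\in\mathbb Z$, $\alpha$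 in a countable set) such that: for every $k$ the $\mathscr U_k^\alpha$ cover $\mathbb R^{N+1}$; if $l\ge k$, then $\mathscr U_l^\beta\subset\mathscr U_k^\alpha$ or $\mathscr U_l^\beta\cap\mathscr U_k^\alpha=\emptyset$; $B(z_k^\alpha,c_1\theta^k)\subset\mathscr U_k^\alpha\subset B(\mathscr U_k^\alpha):=B(z_k^\alpha,C_1\theta^k)$; if $l\ge k$ and $\mathscr U_l^\beta\subset\mathscr U_k^\alpha$, then $B(\mathscr U_l^\beta)\subset B(\mathscr U_k^\alpha)$; and some point $x_0$ is, for every $k$, one of the $z_k^\alpha$. Write $r(\mathcal P)=C_1\theta^k$ for a cube $\mathcal P=\mathscr U_k^\alpha$. An *ultraparabolic cube* is a cube of some such grid (with the fixed $c_1,C_1,\theta$). For $\eta\in(0,1)$, a family $\mathscr G$ of cubes of a dyadic grid is *$\eta$-sparse* if there are pairwise disjoint measurable sets $F_{\mathcal P}\subset\mathcal P$ ($\mathcal P\in\mathscr G$) with $|F_{\mathcal P}|\ge\eta|\mathcal P|$. With $b_{\mathcal P}=\frac1{|\mathcal P|}\int_{\mathcal P}b$, put $$\mathscr A_{\mathscr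 G}f=\sum_{\mathcal P\in\mathscr G}\Big(\frac1{|\mathcal P|}\int_{\mathcal P}|f|\Big)\chi_{\mathcal P},\qquad \mathscr A^{b}_{\mathscr G}f(z)=\sum_{\mathcal P\in\mathscr G}|b(z)-b_{\mathcal P}|\Big(\frac1{|\mathcal P|}\int_{\mathcal P}|f|\Big)\chi_{\mathcal P}(z),$$ $$\mathscr A^{b,*}_{\mathscr G}f=\sum_{\mathcal P\in\mathscr G}\Big(\frac1{|\mathcal P|}\int_{\mathcal P}|b-b_{\mathcal P}|\,|f|\Big)\chi_{\mathcal P}.$$ For $1<p<\infty$ and $p'=p/(p-1)$, a weight $\omega$ (locally integrable, a.e. positive) is in $\mathcal A_p$ if $$[\omega]_{\mathcal A_p}=\sup_{\mathcal P}\Big(\frac1{|\mathcal P|}\int_{\mathcal P}\omega\Big)\Big(\frac1{|\mathcal P|}\int_{\mathcal P}\omega^{1-p'}\Big)^{p-1}<\infty,$$ the supremum being over all ultraparabolic cubes; $L^p(\omega)$ is $L^p$ of the measure $\omega\,dz$. A locally integrable $b$ is *$(\delta,\mathfrak K)$-BMO* if the supremum of $\frac1{|\mathcal B|}\int_{\mathcal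 B}|b-b_{\mathcal B}|$ over all balls $\mathcal B$ of radius $\rho\in(0,\mathfrak K)$ is less than $\delta$. **Lemma.** Let $1<p<\infty$, $\eta\in(0,1)$, and let $\mathscr G$ be an $\eta$-sparse family of cubes of a dyadic grid. 1. There is a constant $C$ depending only on $N,p,\eta$ such that for all $\omega\in\mathcal A_p$ and $f\in L^p(\omega)$ $$\|\mathscr A_{\mathscr G}f\|_{L^p(\omega)}\le C\,[\omega]_{\mathcal A_p}^{\max\{\frac1{p-1},1\}}\|f\|_{L^p(\omega)}.$$ 2. There is a constant $C$ depending only on $N,p,\eta$ and the grid parameters $c_1,C_1,\theta$ such that for all $\delta,\mathfrak K>0$ with $\mathfrak K>r(\mathcal P)$ for every $\mathcal P\in\mathscr G$, all $b\in L^\infty$ that are $(\delta,\mathfrak K)$-BMO, all $\omega\in\mathcal A_p$ and all $f\in L^p(\omega)$ $$\|\mathscr A^{b}_{\mathscr G}f\|_{L^p(\omega)}+\|\mathscr A^{b,*}_{\mathscr G}f\|_{L^p(\omega)}\le C\,\delta\,[\omega]_{\mathcal A_p}^{2\max\{\frac1{p-1},1\}}\|f\|_{L^p(\omega)}.$$ 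-/

import Mathlib

open MeasureTheory
open scoped ENNReal NNReal

noncomputable section

/-- The constant matrix `B` of a Kolmogorov-Fokker-Planck operator, in block form.
The spatial coordinates are grouped into `d + 1` blocks, the `k`-th one of size `s k`;
a spatial index is a pair `⟨k, a⟩` with `k` the block and `a : Fin (s k)`.
The only nonzero blocks of `B` are those directly above the diagonal; the block in position
`(k, k + 1)` has size `s k × s (k + 1)` and rank `s (k + 1)`. -/
structure KolmogorovMatrix where
  d : ℕ
  s : Fin (d + 1) → ℕ
  one_le_s_zero : 1 ≤ s 0
  s_antitone : Antitone s
  B : Matrix (Σ k : Fin (d + 1), Fin (s k)) (Σ k : Fin (d + 1), Fin (s k)) ℝ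
  B_eq_zero : ∀ i j : Σ k : Fin (d + 1), Fin (s k),
    (j.1 : ℕ) ≠ (i.1 : ℕ) + 1 → B i j = 0
  rank_block : ∀ k : Fin d,
    (B.submatrix (fun a : Fin (s k.castSucc) => (⟨k.castSucc, a⟩ : Σ k, Fin (s k)))
      (fun b : Fin (s k.succ) => (⟨k.succ, b⟩ : Σ k, Fin (s k)))).rank = s k.succ

namespace KolmogorovMatrix

/-- The number `N` of spatial variables. -/
def N (K : KolmogorovMatrix) : ℕ := ∑ k, K.s k

/-- The space `ℝ^{N+1}` of points `z = (x, t)`, with its Lebesgue measure. -/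
abbrev Space (K : KolmogorovMatrix) : Type :=
  ((Σ k : Fin (K.d + 1), Fin (K.s k)) → ℝ) × ℝ

variable (K : KolmogorovMatrix)

/-- `F(τ) = exp(-τ Bᵀ)`. -/
def F (τ : ℝ) : Matrix (Σ k : Fin (K.d + 1), Fin (K.s k)) (Σ k : Fin (K.d + 1), Fin (K.s k)) ℝ :=
  NormedSpace.exp (-τ • K.B.transpose)

/-- The group law `(x, t) ∘ (y, τ) = (y + F(τ) x, t + τ)`. -/
def comp (z w : K.Space) : K.Space :=
  (w.1 + (K.F w.2).mulVec z.1, z.2 + w.2)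

/-- The group inverse `(x, t)⁻¹ = (-F(-t) x, -t)`. -/
def inv (z : K.Space) : K.Space :=
  (-(K.F (-z.2)).mulVec z.1, -z.2)

/-- The homogeneous norm: for `z = (x, t) ≠ 0` it is the unique `ρ > 0` with
`∑ x_i² / ρ^{2 a_i} + t² / ρ⁴ = 1`, where `a_i = 2 k + 1` for `i` in the `k`-th block.
For `z = 0` there is no such `ρ` and the infimum of the empty set is `0`. -/
def homNorm (z : K.Space) : ℝ :=
  sInf {ρ : ℝ | 0 < ρ ∧
    ∑ i, z.1 i ^ 2 / ρ ^ (2 * (2 * (i.1 : ℕ) + 1)) + z.2 ^ 2 / ρ ^ 4 = 1}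

/-- The symmetrized homogeneous quasi-metric `‖ξ⁻¹ ∘ z‖ + ‖z⁻¹ ∘ ξ‖`. -/
def qdist (z ξ : K.Space) : ℝ :=
  K.homNorm (K.comp (K.inv ξ) z) + K.homNorm (K.comp (K.inv z) ξ)

/-- The ball `B_r(z)`. -/
def ball (z : K.Space) (r : ℝ) : Set K.Space := {w | K.qdist z w < r}

/-- `b` is `(δ, 𝔎)`-BMO: it is locally integrable and the supremum of its mean oscillations
over all balls of radius less than `𝔎` is less than `δ`. -/
def IsSmallBMO (δ 𝔎 : ℝ) (b : K.Space → ℝ) : Prop :=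
  LocallyIntegrable b ∧
    (⨆ (z : K.Space) (ρ : ℝ) (_ : 0 < ρ) (_ : ρ < 𝔎),
      ⨍⁻ x in K.ball z ρ, ‖b x - ⨍ y in K.ball z ρ, b y‖ₑ ∂volume) < ENNReal.ofReal δ

/-- A general dyadic grid with parameters `c₁`, `C₁`, `θ` on the space of homogeneous type
`(ℝ^{N+1}, d, |·|)`: `cube k α` is the cube with index `α` in generation `k` and `center k α` is the
point attached to it. -/
structure DyadicGrid (c₁ C₁ θ : ℝ) where
  Idx : ℤ → Type
  countable_idx : ∀ k, Countable (Idx k)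
  cube : (k : ℤ) → Idx k → Set K.Space
  center : (k : ℤ) → Idx k → K.Space
  measurableSet_cube : ∀ k α, MeasurableSet (cube k α)
  cover : ∀ k, ⋃ α, cube k α = Set.univ
  nested : ∀ (k l : ℤ), k ≤ l → ∀ (α : Idx k) (β : Idx l),
    cube l β ⊆ cube k α ∨ Disjoint (cube l β) (cube k α)
  ball_subset : ∀ k α, K.ball (center k α) (c₁ * θ ^ k) ⊆ cube k α
  subset_ball : ∀ k α, cube k α ⊆ K.ball (center k α) (C₁ * θ ^ k)
  ball_nested : ∀ (k l : ℤ), k ≤ l → ∀ (α : Idx k) (β : Idx l), cube l β ⊆ cube k α →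
    K.ball (center l β) (C₁ * θ ^ l) ⊆ K.ball (center k α) (C₁ * θ ^ k)
  exists_base : ∃ x₀ : K.Space, ∀ k, ∃ α, center k α = x₀

/-- An ultraparabolic cube is a member of some dyadic grid with the given parameters. -/
def IsUltraparabolicCube (c₁ C₁ θ : ℝ) (P : Set K.Space) : Prop :=
  ∃ (U : K.DyadicGrid c₁ C₁ θ) (k : ℤ) (α : U.Idx k), P = U.cube k α

/-- The Muckenhoupt characteristic `[ω]_{𝒜_p}`, the supremum over all ultraparabolic cubes `P` of
`(⨍_P ω) (⨍_P ω^{1-p'})^{p-1}`, where `p' = p / (p - 1)`. -/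
def apChar (c₁ C₁ θ p : ℝ) (ω : K.Space → ℝ) : ℝ≥0∞ :=
  ⨆ (P : Set K.Space) (_ : K.IsUltraparabolicCube c₁ C₁ θ P),
    (⨍⁻ x in P, ENNReal.ofReal (ω x) ∂volume) *
      (⨍⁻ x in P, ENNReal.ofReal (ω x) ^ (1 - p / (p - 1)) ∂volume) ^ (p - 1)

/-- `ω` is a weight (locally integrable and positive almost everywhere) of class `𝒜_p`. -/
structure IsApWeight (c₁ C₁ θ p : ℝ) (ω : K.Space → ℝ) : Prop where
  locallyIntegrable : LocallyIntegrable ω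
  pos : ∀ᵐ x, 0 < ω x
  apChar_lt_top : K.apChar c₁ C₁ θ p ω < ∞

/-- The measure `ω dz`. -/
def weighted (ω : K.Space → ℝ) : Measure K.Space :=
  volume.withDensity fun x => ENNReal.ofReal (ω x)

namespace DyadicGrid

variable {K} {c₁ C₁ θ : ℝ} (U : K.DyadicGrid c₁ C₁ θ)

/-- The index type of all cubes of the grid. -/
abbrev Cube : Type := Σ k : ℤ, U.Idx k

/-- The set of points of a cube. -/
def pts (P : U.Cube) : Set K.Space := U.cube P.1 P.2

/-- The radius `r(P) = C₁ θ^k` of the ball `B(P)` attached to a cube `P` of generation `k`. -/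
def radius (P : U.Cube) : ℝ := C₁ * θ ^ P.1

/-- `η`-sparse families of cubes. -/
def IsSparse (η : ℝ) (G : Set U.Cube) : Prop :=
  ∃ F : U.Cube → Set K.Space,
    (∀ P ∈ G, MeasurableSet (F P) ∧ F P ⊆ U.pts P ∧
      ENNReal.ofReal η * volume (U.pts P) ≤ volume (F P)) ∧
    G.PairwiseDisjoint F

/-- The sparse operator `∑_{P ∈ G} (⨍_P |f|) χ_P`. -/
def sparseOp (G : Set U.Cube) (f : K.Space → ℝ) (x : K.Space) : ℝ≥0∞ :=
  ∑' P : G, (U.pts P).indicator (fun _ => ⨍⁻ y in U.pts P, ‖f y‖ₑ ∂volume) x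

/-- The operator `∑_{P ∈ G} |b(x) - b_P| (⨍_P |f|) χ_P(x)`. -/
def sparseCommOp (G : Set U.Cube) (b f : K.Space → ℝ) (x : K.Space) : ℝ≥0∞ :=
  ∑' P : G, (U.pts P).indicator
    (fun x => ‖b x - ⨍ y in U.pts P, b y‖ₑ * ⨍⁻ y in U.pts P, ‖f y‖ₑ ∂volume) x

/-- The adjoint operator `∑_{P ∈ G} (⨍_P |b - b_P| |f|) χ_P(x)`. -/
def sparseCommAdjOp (G : Set U.Cube) (b f : K.Space → ℝ) (x : K.Space) : ℝ≥0∞ :=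
  ∑' P : G, (U.pts P).indicator
    (fun _ => ⨍⁻ y in U.pts P, ‖b y - ⨍ w in U.pts P, b w‖ₑ * ‖f y‖ₑ ∂volume) x

end DyadicGrid

end KolmogorovMatrix

end

/-!
All three operators are controlled through bilinear forms, with functions valued in `[0, ∞]`.

*Sparse operators.* Let `V = ω^{1-p'}` be the dual weight. The form of the sparse operator is
`∑ |P|⁻¹ (∫_P h) (∫_P k)`. Writing `h` and `k` as multiples of `V` and `ω`, the term of `P` is the
product of the average of `h / V` for `V dz`, that of `k / ω` for `ω dz`, and `V(P) ω(P) / |P|`. For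
`2 ≤ p` the `A_p` condition and sparseness bound the last factor by a multiple of
`[ω] V(F_P)^{1/p} ω(F_P)^{1/p'}` (`ap_testing`). Hölder's inequality for sums reduces the claim to
the Carleson embedding `∑ ⟨g⟩_P^r ν(F_P) ≤ C ∫ g^r dν` for the measures `V dz` and `ω dz`, which
follows from the weak-type inequality for the dyadic maximal function and the layer-cake formula
(`IsNestedFamily.tsum_average_rpow_le`). No doubling of these measures is needed there, since any
finite union of nested cubes is a disjoint union of some of them. The case `p < 2` follows by exchanging the two weights,
and the bound for the form gives the one for the norm by duality
(`DualWeights.weightedNorm_le_of_forall`).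

*Commutators.* The forms of the other two operators are `∑ ⟨u⟩_P ∫_P |b - b_P| v`, with `u` and `v`
in dual spaces. In a finite family of cubes let `k₀` be the smallest generation. From the cubes of
generation `k₀` a stopping-time construction selects smaller cubes, on which the average of
`|b - b_S|` exceeds twice the bound for the mean oscillation of `b`, where `S` is the cube selected
before (`anchor`). The selected cubes form a sparse family `T`, and
`|b - b_P| ≤ C δ (1 + ∑_{R ∈ T, R ⊆ P} χ_R)` almost everywhere on `P`
(`NestedPartitions.ae_enorm_sub_average_le`). So the form is at most
`C δ ∫ (A_G u) (A_G v + A_T v)`, and two applications of the bound for sparse operators give the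
square of the power of `[ω]`.

*Geometry.* The group law enters through the measures of balls, and through the fact that balls
shrink to points: translations preserve Lebesgue measure, and dilations are automorphisms that
multiply it by a power of the ratio, so the doubling constants of cubes depend on the grid parameters
and on the homogeneous dimension, which is at most `2 N² + 2` (`KolmogorovMatrix.volume_ball_le`).
-/

noncomputable section

/-! ### Countable families of nested sets -/

/-- Any two sets of the family are comparable or disjoint, as dyadic cubes are. -/
def IsNestedFamily {X ι : Type*} (S : ι → Set X) : Prop :=
  ∀ i j, S i ⊆ S j ∨ S j ⊆ S i ∨ Disjoint (S i) (S j)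

section NestedFamily

variable {X ι : Type*} [MeasurableSpace X] {S : ι → Set X}

/-- Every finite union of nested sets is a disjoint union of some of them, so an inequality between
two measures passes from the sets to their union. -/
theorem IsNestedFamily.measure_biUnion_finset_le (hS : IsNestedFamily S)
    (hm : ∀ i, MeasurableSet (S i)) {μ ν : Measure X} (h : ∀ i, μ (S i) ≤ ν (S i))
    (s : Finset ι) : μ (⋃ i ∈ s, S i) ≤ ν (⋃ i ∈ s, S i) := by
  classical
  induction s using Finset.strongInduction with
  | H s ih =>
    rcases s.eq_empty_or_nonempty with rfl | ⟨i, hi⟩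
    · simp
    by_cases hc : ∃ j ∈ s, j ≠ i ∧ S i ⊆ S j
    · obtain ⟨j, hj, hji, hij⟩ := hc
      have : (⋃ k ∈ s, S k) = ⋃ k ∈ s.erase i, S k := by
        apply Set.Subset.antisymm
        · refine Set.iUnion₂_subset fun k hk => ?_
          by_cases hki : k = i
          · subst hki
            exact hij.trans (Set.subset_biUnion_of_mem (u := S)
              (show j ∈ (s.erase k : Finset ι) from Finset.mem_erase.2 ⟨hji, hj⟩))
          · exact Set.subset_biUnion_of_mem (u := S)
              (show k ∈ (s.erase i : Finset ι) from Finset.mem_erase.2 ⟨hki, hk⟩)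
        · exact Set.biUnion_subset_biUnion_left fun k hk => Finset.mem_of_mem_erase hk
      rw [this]
      exact ih _ (Finset.erase_ssubset hi)
    · push Not at hc
      set t := s.filter fun k => Disjoint (S i) (S k) ∧ k ≠ i with ht
      have hts : t ⊂ s := by
        refine Finset.ssubset_iff_subset_ne.2 ⟨Finset.filter_subset _ _, fun he => ?_⟩
        have := he ▸ hi
        simp [ht] at this
      have hu : (⋃ k ∈ s, S k) = S i ∪ ⋃ k ∈ t, S k := by
        apply Set.Subset.antisymm
        · refine Set.iUnion₂_subset fun k hk => ?_
          by_cases hki : k = i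
          · subst hki; exact Set.subset_union_left
          · rcases hS i k with h1 | h1 | h1
            · exact absurd h1 (hc k hk hki)
            · exact h1.trans Set.subset_union_left
            · exact (Set.subset_biUnion_of_mem (u := S)
                (show k ∈ t from Finset.mem_filter.2 ⟨hk, h1, hki⟩)).trans Set.subset_union_right
        · refine Set.union_subset (Set.subset_biUnion_of_mem (u := S) hi) ?_
          exact Set.biUnion_subset_biUnion_left hts.subset
      have hd : Disjoint (S i) (⋃ k ∈ t, S k) := by
        simp only [Set.disjoint_iUnion_right]
        exact fun k hk => (Finset.mem_filter.1 hk).2.1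
      have hmt : MeasurableSet (⋃ k ∈ t, S k) := t.measurableSet_biUnion fun k _ => hm k
      rw [hu, measure_union hd hmt, measure_union hd hmt]
      exact add_le_add (h i) (ih t hts)

theorem IsNestedFamily.measure_iUnion_le [Countable ι] (hS : IsNestedFamily S)
    (hm : ∀ i, MeasurableSet (S i)) {μ ν : Measure X} (h : ∀ i, μ (S i) ≤ ν (S i)) :
    μ (⋃ i, S i) ≤ ν (⋃ i, S i) := by
  have hd : Directed (· ⊆ ·) fun s : Finset ι => ⋃ i ∈ s, S i :=
    directed_of_isDirected_le fun s t hst => Set.biUnion_subset_biUnion_left hst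
  rw [Set.iUnion_eq_iUnion_finset, hd.measure_iUnion]
  exact iSup_le fun s => (hS.measure_biUnion_finset_le hm h s).trans
    (measure_mono (Set.subset_iUnion (fun s : Finset ι => ⋃ i ∈ s, S i) s))

end NestedFamily

/-! ### The Carleson embedding -/

theorem lintegral_Ioi_indicator_rpow {s : ℝ} (hs : -1 < s) (a : ℝ≥0∞) :
    ∫⁻ l in Set.Ioi (0 : ℝ), {l : ℝ | ENNReal.ofReal l < a}.indicator
      (fun l => ENNReal.ofReal (l ^ s)) l = a ^ (s + 1) / ENNReal.ofReal (s + 1) := by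
  have hs' : 0 < s + 1 := by linarith
  have hreal : ∀ c : ℝ, 0 < c → ∫⁻ l in Set.Ioo (0 : ℝ) c, ENNReal.ofReal (l ^ s) =
      ENNReal.ofReal c ^ (s + 1) / ENNReal.ofReal (s + 1) := by
    intro c hc
    have hint : IntegrableOn (fun l : ℝ => l ^ s) (Set.Ioc 0 c) :=
      (intervalIntegrable_iff_integrableOn_Ioc_of_le hc.le).1
        (intervalIntegral.intervalIntegrable_rpow' hs)
    rw [integrableOn_Ioc_iff_integrableOn_Ioo] at hint
    rw [← ofReal_integral_eq_lintegral_ofReal hint, restrict_Ioo_eq_restrict_Ioc,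
      ← intervalIntegral.integral_of_le hc.le, integral_rpow (Or.inl hs),
      Real.zero_rpow hs'.ne', sub_zero, ENNReal.ofReal_div_of_pos hs',
      ENNReal.ofReal_rpow_of_pos hc]
    refine (ae_restrict_iff' measurableSet_Ioo).2 (ae_of_all _ fun l hl => ?_)
    exact Real.rpow_nonneg hl.1.le _
  have hset : ∀ c : ℝ≥0∞, MeasurableSet {l : ℝ | ENNReal.ofReal l < c} := fun c =>
    measurableSet_lt ENNReal.measurable_ofReal measurable_const
  rw [lintegral_indicator (hset a), Measure.restrict_restrict (hset a)]
  induction a with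
  | top =>
    rw [ENNReal.top_rpow_of_pos hs', ENNReal.top_div_of_ne_top ENNReal.ofReal_ne_top, eq_top_iff]
    have : Filter.Tendsto (fun n : ℕ => ENNReal.ofReal (n + 1 : ℝ) ^ (s + 1) /
        ENNReal.ofReal (s + 1)) Filter.atTop (nhds ⊤) := by
      have h1 : Filter.Tendsto (fun n : ℕ => ENNReal.ofReal (((n : ℝ) + 1) ^ (s + 1) / (s + 1)))
          Filter.atTop (nhds ⊤) := by
        refine ENNReal.tendsto_ofReal_atTop.comp ?_
        refine Filter.Tendsto.atTop_div_const hs' ?_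
        refine (tendsto_rpow_atTop hs').comp ?_
        exact Filter.tendsto_atTop_add_const_right _ _ tendsto_natCast_atTop_atTop
      refine h1.congr fun n => ?_
      rw [ENNReal.ofReal_div_of_pos hs', ENNReal.ofReal_rpow_of_pos (by positivity)]
    refine le_of_tendsto' this fun n => ?_
    rw [← hreal _ (by positivity)]
    refine lintegral_mono_set fun l hl => ⟨by simp, hl.1⟩
  | coe c =>
    rcases eq_or_ne c 0 with rfl | hc
    · simp [ENNReal.zero_rpow_of_pos hs']
    · have hc' : (0 : ℝ) < c := by positivity
      have : {l : ℝ | ENNReal.ofReal l < c} ∩ Set.Ioi 0 = Set.Ioo 0 (c : ℝ) := by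
        ext l
        simp only [Set.mem_inter_iff, Set.mem_ofPred_eq, Set.mem_Ioi, Set.mem_Ioo]
        constructor
        · rintro ⟨h1, h2⟩
          refine ⟨h2, ?_⟩
          rw [← ENNReal.ofReal_coe_nnreal] at h1
          exact (ENNReal.ofReal_lt_ofReal_iff hc').1 h1
        · rintro ⟨h1, h2⟩
          refine ⟨?_, h1⟩
          rw [← ENNReal.ofReal_coe_nnreal]
          exact (ENNReal.ofReal_lt_ofReal_iff hc').2 h2
      rw [this, hreal _ hc', ENNReal.ofReal_coe_nnreal]

/-- The constant of the Carleson embedding in `L^p`. -/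
def carlesonConst (p : ℝ) : ℝ≥0∞ := ENNReal.ofReal (p * 2 ^ p / (p - 1))

section Carleson

variable {X ι : Type*} [MeasurableSpace X] {S : ι → Set X}

/-- The weak-type inequality for the dyadic maximal function; only the part of `f` above half the
level enters, which makes it self-improving to the strong type without knowing that the maximal
function is finite. -/
theorem IsNestedFamily.mul_measure_iUnion_lt_average_le [Countable ι] (hS : IsNestedFamily S)
    (hm : ∀ i, MeasurableSet (S i)) (ν : Measure X) {f : X → ℝ≥0∞} (hf : Measurable f) {l : ℝ}
    (hl : 0 < l) :
    ENNReal.ofReal (l / 2) *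
        ν (⋃ i : {i // ENNReal.ofReal l < (∫⁻ x in S i, f x ∂ν) / ν (S i)}, S i) ≤
      ∫⁻ x, {x | ENNReal.ofReal l < 2 * f x}.indicator f x ∂ν := by
  set g : X → ℝ≥0∞ := {x | ENNReal.ofReal l < 2 * f x}.indicator f with hg
  have hset : MeasurableSet {x | ENNReal.ofReal l < 2 * f x} :=
    measurableSet_lt measurable_const (hf.const_mul 2)
  have hle : ∀ x, f x ≤ ENNReal.ofReal (l / 2) + g x := by
    intro x
    by_cases hx : ENNReal.ofReal l < 2 * f x
    · have : g x = f x := Set.indicator_of_mem (s := {x | ENNReal.ofReal l < 2 * f x}) hx f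
      rw [this]; exact le_add_self
    · refine le_add_right ?_
      rw [ENNReal.ofReal_div_of_pos two_pos, ENNReal.le_div_iff_mul_le (by simp) (by simp)]
      rw [mul_comm]
      simpa using not_lt.1 hx
  have key := IsNestedFamily.measure_iUnion_le
    (S := fun i : {i // ENNReal.ofReal l < (∫⁻ x in S i, f x ∂ν) / ν (S i)} => S i)
    (μ := ENNReal.ofReal (l / 2) • ν) (ν := ν.withDensity g)
    (fun i j => hS i j) (fun i => hm i) (fun i => by
      obtain ⟨i, hi⟩ := i
      have hfin : ν (S i) ≠ ∞ := fun h => by simp [h] at hi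
      rw [withDensity_apply _ (hm i), Measure.smul_apply, smul_eq_mul]
      have h1 : ENNReal.ofReal l * ν (S i) ≤ ∫⁻ x in S i, f x ∂ν := ENNReal.mul_le_of_le_div hi.le
      have h2 : ∫⁻ x in S i, f x ∂ν ≤
          ENNReal.ofReal (l / 2) * ν (S i) + ∫⁻ x in S i, g x ∂ν := by
        refine (lintegral_mono hle).trans_eq ?_
        rw [lintegral_add_left measurable_const, setLIntegral_const]
      have h3 : ENNReal.ofReal l * ν (S i) =
          ENNReal.ofReal (l / 2) * ν (S i) + ENNReal.ofReal (l / 2) * ν (S i) := by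
        rw [← add_mul, ← ENNReal.ofReal_add (by positivity) (by positivity), add_halves]
      rw [h3] at h1
      exact (ENNReal.add_le_add_iff_left (ENNReal.mul_ne_top ENNReal.ofReal_ne_top hfin)).1
        (h1.trans h2))
  rw [Measure.smul_apply, smul_eq_mul] at key
  refine key.trans ?_
  rw [withDensity_apply _ (MeasurableSet.iUnion fun i : {i // _} => hm i.1)]
  exact setLIntegral_le_lintegral _ _

theorem IsNestedFamily.tsum_average_rpow_le [Countable ι] (hS : IsNestedFamily S)
    (hm : ∀ i, MeasurableSet (S i)) {F : ι → Set X} (hFm : ∀ i, MeasurableSet (F i))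
    (hFS : ∀ i, F i ⊆ S i) (hF : Pairwise (Function.onFun Disjoint F)) {p : ℝ} (hp : 1 < p)
    (ν : Measure X) [SFinite ν] {f : X → ℝ≥0∞} (hf : Measurable f) :
    ∑' i, ((∫⁻ x in S i, f x ∂ν) / ν (S i)) ^ p * ν (F i) ≤
      carlesonConst p * ∫⁻ x, f x ^ p ∂ν := by
  set a : ι → ℝ≥0∞ := fun i => (∫⁻ x in S i, f x ∂ν) / ν (S i) with ha
  have hset : ∀ c : ℝ≥0∞, MeasurableSet {l : ℝ | ENNReal.ofReal l < c} := fun c =>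
    measurableSet_lt ENNReal.measurable_ofReal measurable_const
  have hmr : ∀ s : ℝ, Measurable fun l : ℝ => ENNReal.ofReal (l ^ s) := fun s => by fun_prop
  -- The layer-cake formula for `a i ^ p`.
  have hap : ∀ i, a i ^ p = ENNReal.ofReal p * ∫⁻ l in Set.Ioi (0 : ℝ),
      {l : ℝ | ENNReal.ofReal l < a i}.indicator (fun l => ENNReal.ofReal (l ^ (p - 1))) l := by
    intro i
    rw [lintegral_Ioi_indicator_rpow (by linarith), sub_add_cancel, ENNReal.mul_div_cancel
      (by simp; linarith) ENNReal.ofReal_ne_top]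
  have hpt : ∀ l ∈ Set.Ioi (0 : ℝ), ∑' i, {l : ℝ | ENNReal.ofReal l < a i}.indicator
      (fun l => ENNReal.ofReal (l ^ (p - 1))) l * ν (F i) ≤
      ENNReal.ofReal (2 * l ^ (p - 2)) *
        ∫⁻ x, {x | ENNReal.ofReal l < 2 * f x}.indicator f x ∂ν := by
    intro l hl
    have hl : 0 < l := hl
    have h1 : ∑' i, {l : ℝ | ENNReal.ofReal l < a i}.indicator
        (fun l => ENNReal.ofReal (l ^ (p - 1))) l * ν (F i) =
        ENNReal.ofReal (l ^ (p - 1)) * ∑' i : {i // ENNReal.ofReal l < a i}, ν (F i) := by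
      rw [← ENNReal.tsum_mul_left]
      rw [show (∑' i : {i // ENNReal.ofReal l < a i}, ENNReal.ofReal (l ^ (p - 1)) * ν (F i)) =
        ∑' i, {i | ENNReal.ofReal l < a i}.indicator
          (fun i => ENNReal.ofReal (l ^ (p - 1)) * ν (F i)) i from
        tsum_subtype {i | ENNReal.ofReal l < a i} (fun i => ENNReal.ofReal (l ^ (p - 1)) * ν (F i))]
      refine tsum_congr fun i => ?_
      by_cases h : ENNReal.ofReal l < a i <;> simp [Set.indicator, h]
    have h2 : ∑' i : {i // ENNReal.ofReal l < a i}, ν (F i) ≤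
        ν (⋃ i : {i // ENNReal.ofReal l < a i}, S i) := by
      rw [← measure_iUnion (f := fun i : {i // ENNReal.ofReal l < a i} => F i)
        (fun i j hij => hF (Subtype.coe_injective.ne hij)) fun i => hFm i]
      exact measure_mono (Set.iUnion_mono fun i => hFS i)
    have h3 := hS.mul_measure_iUnion_lt_average_le hm ν hf hl
    have h4 : ENNReal.ofReal (l ^ (p - 1)) =
        ENNReal.ofReal (2 * l ^ (p - 2)) * ENNReal.ofReal (l / 2) := by
      rw [← ENNReal.ofReal_mul (by positivity)]
      congr 1
      rw [show p - 1 = (p - 2) + 1 by ring, Real.rpow_add hl, Real.rpow_one]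
      ring
    rw [h1, h4, mul_assoc]
    gcongr
    exact (mul_le_mul_right h2 _).trans h3
  have hmeas : AEMeasurable (Function.uncurry fun (l : ℝ) (x : X) =>
      ENNReal.ofReal (2 * l ^ (p - 2)) * {x | ENNReal.ofReal l < 2 * f x}.indicator f x)
      ((volume.restrict (Set.Ioi (0 : ℝ))).prod ν) := by
    refine Measurable.aemeasurable ?_
    refine Measurable.mul (by fun_prop) ?_
    have : (fun z : ℝ × X => {x | ENNReal.ofReal z.1 < 2 * f x}.indicator f z.2) =
        {z : ℝ × X | ENNReal.ofReal z.1 < 2 * f z.2}.indicator fun z => f z.2 := by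
      ext z; simp [Set.indicator]
    change Measurable fun z : ℝ × X => {x | ENNReal.ofReal z.1 < 2 * f x}.indicator f z.2
    rw [this]
    exact (hf.comp measurable_snd).indicator
      (measurableSet_lt (by fun_prop) (by fun_prop))
  calc ∑' i, a i ^ p * ν (F i)
      = ENNReal.ofReal p * ∫⁻ l in Set.Ioi (0 : ℝ), ∑' i, {l : ℝ | ENNReal.ofReal l < a i}.indicator
          (fun l => ENNReal.ofReal (l ^ (p - 1))) l * ν (F i) := by
        rw [lintegral_tsum fun i => (((hmr _).indicator (hset _)).mul_const _).aemeasurable,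
          ← ENNReal.tsum_mul_left]
        refine tsum_congr fun i => ?_
        rw [lintegral_mul_const _ ((hmr _).indicator (hset _)), hap, mul_assoc]
    _ ≤ ENNReal.ofReal p * ∫⁻ l in Set.Ioi (0 : ℝ), ∫⁻ x, ENNReal.ofReal (2 * l ^ (p - 2)) *
          {x | ENNReal.ofReal l < 2 * f x}.indicator f x ∂ν := by
        refine mul_le_mul_right ?_ _
        refine setLIntegral_mono' measurableSet_Ioi fun l hl => (hpt l hl).trans_eq ?_
        rw [lintegral_const_mul]
        exact hf.indicator (measurableSet_lt measurable_const (hf.const_mul 2))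
    _ = ENNReal.ofReal p * ∫⁻ x, (∫⁻ l in Set.Ioi (0 : ℝ), ENNReal.ofReal (2 * l ^ (p - 2)) *
          {x | ENNReal.ofReal l < 2 * f x}.indicator f x) ∂ν := by
        rw [lintegral_lintegral_swap hmeas]
    _ = ENNReal.ofReal p * ∫⁻ x, ENNReal.ofReal (2 ^ p / (p - 1)) * f x ^ p ∂ν := by
        congr 1
        refine lintegral_congr fun x => ?_
        have h1 : ∀ l : ℝ, ENNReal.ofReal (2 * l ^ (p - 2)) *
            {x | ENNReal.ofReal l < 2 * f x}.indicator f x =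
            (2 * f x) * {l : ℝ | ENNReal.ofReal l < 2 * f x}.indicator
              (fun l => ENNReal.ofReal (l ^ (p - 2))) l := by
          intro l
          rw [ENNReal.ofReal_mul zero_le_two, ENNReal.ofReal_ofNat]
          by_cases h : ENNReal.ofReal l < 2 * f x
          · simp only [Set.indicator, Set.mem_ofPred_eq, h, if_true]; ring
          · simp [Set.indicator, h]
        simp_rw [h1]
        rw [lintegral_const_mul _ ((hmr _).indicator (hset _)),
          lintegral_Ioi_indicator_rpow (by linarith), show p - 2 + 1 = p - 1 by ring,
          ← mul_div_assoc]
        have h2 : (2 * f x) * (2 * f x) ^ (p - 1) = (2 * f x) ^ p := by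
          nth_rw 1 [← ENNReal.rpow_one (2 * f x)]
          rw [← ENNReal.rpow_add_of_nonneg _ _ zero_le_one (by linarith), add_sub_cancel]
        rw [h2, ENNReal.mul_rpow_of_nonneg _ _ (by linarith), ENNReal.ofReal_div_of_pos
          (by linarith), ← ENNReal.ofReal_rpow_of_pos two_pos, ENNReal.ofReal_ofNat,
          ENNReal.div_eq_inv_mul, ENNReal.div_eq_inv_mul, mul_assoc]
    _ = carlesonConst p * ∫⁻ x, f x ^ p ∂ν := by
        rw [lintegral_const_mul _ (hf.pow_const _), ← mul_assoc, carlesonConst,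
          ← ENNReal.ofReal_mul (by linarith), mul_div_assoc]

/-- The Carleson embedding theorem: averages over sparse cubes are controlled in `ℓ^p`. -/
theorem IsNestedFamily.tsum_average_rpow_le_of_aemeasurable [Countable ι] (hS : IsNestedFamily S)
    (hm : ∀ i, MeasurableSet (S i)) {F : ι → Set X} (hFm : ∀ i, MeasurableSet (F i))
    (hFS : ∀ i, F i ⊆ S i) (hF : Pairwise (Function.onFun Disjoint F)) {p : ℝ} (hp : 1 < p)
    (ν : Measure X) [SFinite ν] {f : X → ℝ≥0∞} (hf : AEMeasurable f ν) :
    ∑' i, ((∫⁻ x in S i, f x ∂ν) / ν (S i)) ^ p * ν (F i) ≤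
      carlesonConst p * ∫⁻ x, f x ^ p ∂ν := by
  have h1 : ∀ i, ∫⁻ x in S i, f x ∂ν = ∫⁻ x in S i, hf.mk f x ∂ν := fun i =>
    lintegral_congr_ae (ae_restrict_of_ae hf.ae_eq_mk)
  have h2 : ∫⁻ x, f x ^ p ∂ν = ∫⁻ x, hf.mk f x ^ p ∂ν :=
    lintegral_congr_ae (hf.ae_eq_mk.mono fun x hx => by simp only [hx])
  simp only [h1, h2]
  exact hS.tsum_average_rpow_le hm hFm hFS hF hp ν hf.measurable_mk

theorem carlesonConst_ne_top (p : ℝ) : carlesonConst p ≠ ∞ := ENNReal.ofReal_ne_top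

end Carleson

/-! ### Weighted norms and duality -/

section Weights

variable {X : Type*} [MeasurableSpace X]

/-- The norm `(∫ |u|^p W dμ)^{1/p}` of `L^p(W dμ)` for functions with values in `[0, ∞]`. -/
def weightedNorm (μ : Measure X) (p : ℝ) (W u : X → ℝ≥0∞) : ℝ≥0∞ :=
  (∫⁻ x, u x ^ p * W x ∂μ) ^ (1 / p)

/-- The weights `W` and `V = W^{1-q}`, where `q` is the exponent conjugate to `p`, are dual to each
other: the spaces `L^p(W)` and `L^q(V)` are dual with respect to the pairing `∫ u v dμ`. -/
structure DualWeights (μ : Measure X) (p q : ℝ) (W V : X → ℝ≥0∞) : Prop where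
  conj : p.HolderConjugate q
  measurable_left : Measurable W
  measurable_right : Measurable V
  ae : ∀ᵐ x ∂μ, W x ≠ 0 ∧ W x ≠ ∞ ∧ V x = W x ^ (1 - q)

namespace DualWeights

variable {μ : Measure X} {p q : ℝ} {W V : X → ℝ≥0∞}

theorem one_sub_mul_one_sub (h : DualWeights μ p q W V) : (1 - q) * (1 - p) = 1 := by
  have := h.conj.mul_eq_add
  linarith

theorem ae_right (h : DualWeights μ p q W V) : ∀ᵐ x ∂μ, V x ≠ 0 ∧ V x ≠ ∞ := by
  filter_upwards [h.ae] with x hx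
  rw [hx.2.2]
  exact ⟨fun h0 => by rw [ENNReal.rpow_eq_zero_iff] at h0; tauto,
    ENNReal.rpow_ne_top_of_ne_zero hx.1 hx.2.1⟩

theorem symm (h : DualWeights μ p q W V) : DualWeights μ q p V W where
  conj := h.conj.symm
  measurable_left := h.measurable_right
  measurable_right := h.measurable_left
  ae := by
    filter_upwards [h.ae, h.ae_right] with x hx hx'
    refine ⟨hx'.1, hx'.2, ?_⟩
    rw [hx.2.2, ← ENNReal.rpow_mul, h.one_sub_mul_one_sub, ENNReal.rpow_one]

theorem restrict (h : DualWeights μ p q W V) (s : Set X) : DualWeights (μ.restrict s) p q W V :=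
  ⟨h.conj, h.measurable_left, h.measurable_right, ae_restrict_of_ae h.ae⟩

theorem lintegral_mul_le (h : DualWeights μ p q W V) {u v : X → ℝ≥0∞} (hu : Measurable u)
    (hv : Measurable v) :
    ∫⁻ x, u x * v x ∂μ ≤ weightedNorm μ p W u * weightedNorm μ q V v := by
  have hp := h.conj.pos
  have hq := h.conj.symm.pos
  have hW := h.measurable_left
  have hV := h.measurable_right
  have key := ENNReal.lintegral_mul_le_Lp_mul_Lq μ h.conj
    (f := fun x => u x * W x ^ (1 / p)) (g := fun x => v x * V x ^ (1 / q))
    (by fun_prop) (by fun_prop)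
  have e1 : ∀ {r : ℝ}, 0 < r → ∀ (f w : X → ℝ≥0∞),
      (∫⁻ x, (f x * w x ^ (1 / r)) ^ r ∂μ) = ∫⁻ x, f x ^ r * w x ∂μ := by
    intro r hr f w
    refine lintegral_congr fun x => ?_
    rw [ENNReal.mul_rpow_of_nonneg _ _ hr.le, ← ENNReal.rpow_mul, one_div_mul_cancel hr.ne',
      ENNReal.rpow_one]
  rw [e1 hp, e1 hq] at key
  refine (lintegral_mono_ae ?_).trans key
  filter_upwards [h.ae] with x hx
  refine le_of_eq ?_
  have : W x ^ (1 / p) * V x ^ (1 / q) = 1 := by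
    rw [hx.2.2, ← ENNReal.rpow_mul, ← ENNReal.rpow_add _ _ hx.1 hx.2.1]
    have h1 := h.conj.inv_add_inv_eq_one
    have : 1 / p + (1 - q) * (1 / q) = 0 := by
      rw [sub_mul, mul_one_div_cancel hq.ne']
      simp only [one_div, one_mul]
      linarith
    rw [this, ENNReal.rpow_zero]
  simp only [Pi.mul_apply]
  calc u x * v x = u x * v x * 1 := (mul_one _).symm
    _ = _ := by rw [← this]; ring

theorem measure_le (h : DualWeights μ p q W V) (s : Set X) :
    μ s ≤ (∫⁻ x in s, W x ∂μ) ^ (1 / p) * (∫⁻ x in s, V x ∂μ) ^ (1 / q) := by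
  have := (h.restrict s).lintegral_mul_le (u := fun _ => 1) (v := fun _ => 1) measurable_const
    measurable_const
  simpa [weightedNorm] using this

theorem lintegral_ne_zero (h : DualWeights μ p q W V) {s : Set X} (hs : μ s ≠ 0) :
    ∫⁻ x in s, W x ∂μ ≠ 0 := by
  intro h0
  have := h.measure_le s
  rw [h0, ENNReal.zero_rpow_of_pos (by have := h.conj.pos; positivity), zero_mul] at this
  exact hs (le_zero_iff.1 this)

theorem sigmaFinite_withDensity [SigmaFinite μ] (h : DualWeights μ p q W V) :
    SigmaFinite (μ.withDensity W) :=
  SigmaFinite.withDensity_of_ne_top (h.ae.mono fun _ hx => hx.2.1)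

/-- A function is in `L^p(W)` with norm at most `M` if its pairing with every function of
`L^q(V)` is at most `M` times the norm. -/
theorem weightedNorm_le_of_forall [SigmaFinite μ] (h : DualWeights μ p q W V) {u : X → ℝ≥0∞}
    (hu : Measurable u) {M : ℝ≥0∞}
    (hM : ∀ v : X → ℝ≥0∞, Measurable v → ∫⁻ x, u x * v x ∂μ ≤ M * weightedNorm μ q V v) :
    weightedNorm μ p W u ≤ M := by
  have hp := h.conj.pos
  have hq := h.conj.symm.pos
  have hW := h.measurable_left
  have := h.sigmaFinite_withDensity
  rw [weightedNorm, one_div, ENNReal.rpow_inv_le_iff hp]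
  have e : ∀ f : X → ℝ≥0∞, Measurable f →
      ∫⁻ x, f x * W x ∂μ = ∫⁻ x, f x ∂(μ.withDensity W) := by
    intro f hf
    rw [lintegral_withDensity_eq_lintegral_mul _ hW hf]
    exact lintegral_congr fun x => mul_comm _ _
  rw [e _ (hu.pow_const p)]
  refine le_of_forall_lt fun L hL => ?_
  -- A simple function below `u ^ p` of finite integral serves to build the test function.
  rw [lintegral_eq_nnreal] at hL
  obtain ⟨φ₀, hL⟩ := lt_iSup_iff.1 hL
  obtain ⟨hφ₀u, hL⟩ := lt_iSup_iff.1 hL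
  rw [← SimpleFunc.lintegral_eq_lintegral] at hL
  obtain ⟨φ, hφφ₀, hφt, hφL⟩ := exists_lt_lintegral_simpleFunc_of_lt_lintegral
    (μ := μ.withDensity W) (f := fun x => φ₀ x) hL
  have hφm : Measurable fun x => (φ x : ℝ≥0∞) := φ.measurable.coe_nnreal_ennreal
  set Φ := ∫⁻ x, φ x ∂(μ.withDensity W) with hΦ
  have hφu : ∀ x, (φ x : ℝ≥0∞) ≤ u x ^ p := fun x =>
    (ENNReal.coe_le_coe.2 (hφφ₀ x)).trans (hφ₀u x)
  have hpq : 1 / p + 1 / q = 1 := by simpa using h.conj.inv_add_inv_eq_one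
  have hsplit : ∀ a : ℝ≥0∞, a = a ^ (1 / p) * a ^ (1 / q) := fun a => by
    rw [← ENNReal.rpow_add_of_nonneg _ _ (by positivity) (by positivity), hpq, ENNReal.rpow_one]
  have h1 := hM (fun x => (φ x : ℝ≥0∞) ^ (1 / q) * W x) (by fun_prop)
  have h2 : weightedNorm μ q V (fun x => (φ x : ℝ≥0∞) ^ (1 / q) * W x) = Φ ^ (1 / q) := by
    rw [weightedNorm, hΦ, ← e _ hφm]
    congr 1
    refine lintegral_congr_ae ?_
    filter_upwards [h.ae] with x hx
    rw [ENNReal.mul_rpow_of_nonneg _ _ hq.le, ← ENNReal.rpow_mul, one_div_mul_cancel hq.ne',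
      ENNReal.rpow_one, hx.2.2, mul_assoc, ← ENNReal.rpow_add _ _ hx.1 hx.2.1,
      add_sub_cancel, ENNReal.rpow_one]
  have h3 : Φ ≤ ∫⁻ x, u x * ((φ x : ℝ≥0∞) ^ (1 / q) * W x) ∂μ := by
    rw [hΦ, ← e _ hφm]
    refine lintegral_mono fun x => ?_
    rw [← mul_assoc]
    refine mul_le_mul_left ?_ _
    nth_rw 1 [hsplit (φ x)]
    refine mul_le_mul_left ?_ _
    rw [one_div, ENNReal.rpow_inv_le_iff hp]
    exact hφu x
  rw [h2] at h1
  refine hφL.trans_le ?_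
  rcases eq_or_ne Φ 0 with h0 | h0
  · rw [h0]; exact zero_le
  have h4 : Φ ^ (1 / p) * Φ ^ (1 / q) ≤ M * Φ ^ (1 / q) := by
    rw [← hsplit]; exact h3.trans h1
  rw [← ENNReal.rpow_inv_le_iff hp, ← one_div]
  refine (ENNReal.mul_le_mul_iff_left ?_ ?_).1 h4
  · intro h0'
    rw [ENNReal.rpow_eq_zero_iff] at h0'
    rcases h0' with h0' | h0'
    · exact h0 h0'.1
    · exact hφt.ne h0'.1
  · exact ENNReal.rpow_ne_top_of_nonneg (by positivity) hφt.ne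

end DualWeights

end Weights

/-! ### Weighted bounds for sparse operators -/

section Sparse

variable {X ι : Type*} [MeasurableSpace X] {μ : Measure X} {S F : ι → Set X}

/-- A family of nested sets `S i` of positive finite measure is `η`-sparse if each `S i` has a
subset `F i` of proportion at least `η` such that the sets `F i` are pairwise disjoint. -/
structure IsSparseFamily (μ : Measure X) (η : ℝ) (S F : ι → Set X) : Prop where
  nested : IsNestedFamily S
  measurableSet : ∀ i, MeasurableSet (S i)
  measure_ne_zero : ∀ i, μ (S i) ≠ 0
  measure_ne_top : ∀ i, μ (S i) ≠ ∞
  measurableSet_right : ∀ i, MeasurableSet (F i)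
  subset : ∀ i, F i ⊆ S i
  pairwise_disjoint : Pairwise (Function.onFun Disjoint F)
  le_measure : ∀ i, ENNReal.ofReal η * μ (S i) ≤ μ (F i)

theorem IsSparseFamily.comp_injective {η : ℝ} (h : IsSparseFamily μ η S F) {κ : Type*} {φ : κ → ι}
    (hφ : Function.Injective φ) : IsSparseFamily μ η (fun i => S (φ i)) (fun i => F (φ i)) where
  nested i j := h.nested (φ i) (φ j)
  measurableSet i := h.measurableSet (φ i)
  measure_ne_zero i := h.measure_ne_zero (φ i)
  measure_ne_top i := h.measure_ne_top (φ i)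
  measurableSet_right i := h.measurableSet_right (φ i)
  subset i := h.subset (φ i)
  pairwise_disjoint _ _ hij := h.pairwise_disjoint (hφ.ne hij)
  le_measure i := h.le_measure (φ i)

/-- The operator `∑ i, (⨍_{S i} h) χ_{S i}`. -/
def averagingOp (μ : Measure X) (S : ι → Set X) (h : X → ℝ≥0∞) (x : X) : ℝ≥0∞ :=
  ∑' i, (S i).indicator (fun _ => ⨍⁻ y in S i, h y ∂μ) x

theorem measurable_averagingOp [Countable ι] (hS : ∀ i, MeasurableSet (S i)) (h : X → ℝ≥0∞) :
    Measurable (averagingOp μ S h) :=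
  Measurable.tsum fun i => measurable_const.indicator (hS i)

theorem lintegral_tsum_indicator_mul [Countable ι] (hS : ∀ i, MeasurableSet (S i))
    {g : ι → X → ℝ≥0∞} (hg : ∀ i, Measurable (g i)) {k : X → ℝ≥0∞} (hk : Measurable k) :
    ∫⁻ x, (∑' i, (S i).indicator (g i) x) * k x ∂μ = ∑' i, ∫⁻ y in S i, g i y * k y ∂μ := by
  simp only [← ENNReal.tsum_mul_right]
  have hm : ∀ i, AEMeasurable (fun x => (S i).indicator (g i) x * k x) μ := fun i =>
    (((hg i).indicator (hS i)).mul hk).aemeasurable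
  rw [lintegral_tsum hm]
  refine tsum_congr fun i => ?_
  rw [← lintegral_indicator (hS i)]
  refine lintegral_congr fun x => ?_
  by_cases hx : x ∈ S i <;> simp [hx]

theorem lintegral_averagingOp_mul [Countable ι] (hS : ∀ i, MeasurableSet (S i)) (h : X → ℝ≥0∞)
    {k : X → ℝ≥0∞} (hk : Measurable k) :
    ∫⁻ x, averagingOp μ S h x * k x ∂μ =
      ∑' i, (⨍⁻ y in S i, h y ∂μ) * ∫⁻ y in S i, k y ∂μ := by
  refine (lintegral_tsum_indicator_mul hS (fun _ => measurable_const) hk).trans ?_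
  exact tsum_congr fun i => lintegral_const_mul _ hk

theorem lintegral_averagingOp_mul_comm [Countable ι] (hS : ∀ i, MeasurableSet (S i))
    {h k : X → ℝ≥0∞} (hh : Measurable h) (hk : Measurable k) :
    ∫⁻ x, averagingOp μ S h x * k x ∂μ = ∫⁻ x, averagingOp μ S k x * h x ∂μ := by
  rw [lintegral_averagingOp_mul hS h hk, lintegral_averagingOp_mul hS k hh]
  refine tsum_congr fun i => ?_
  simp only [setLAverage_eq, ENNReal.div_eq_inv_mul]
  ring

theorem tsum_mul_le_Lp_mul_Lq {p q : ℝ} (hpq : p.HolderConjugate q) (f g : ι → ℝ≥0∞) :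
    ∑' i, f i * g i ≤ (∑' i, f i ^ p) ^ (1 / p) * (∑' i, g i ^ q) ^ (1 / q) := by
  have hp := hpq.pos
  have hq := hpq.symm.pos
  rw [ENNReal.tsum_eq_iSup_sum]
  refine iSup_le fun s => (ENNReal.inner_le_Lp_mul_Lq s f g hpq).trans ?_
  exact mul_le_mul' (ENNReal.rpow_le_rpow (ENNReal.sum_le_tsum s) (by positivity))
    (ENNReal.rpow_le_rpow (ENNReal.sum_le_tsum s) (by positivity))

/-- The pointwise estimate behind the sharp weighted bound for `2 ≤ p`; the exponent of the
`A_p` quantity `A` is `1` because `2 - p ≤ 0` allows `V` to be replaced by the smaller `V'`. -/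
theorem ap_testing_real {p q A η x y w v w' v' : ℝ} (hpq : p.HolderConjugate q) (hp : 2 ≤ p)
    (hη : 0 < η) (hA : 0 ≤ A) (hx : 0 < x) (hy : η * x ≤ y) (hw' : 0 < w') (hv' : 0 < v')
    (hv : 0 < v) (hvv : v' ≤ v) (hyw : y ≤ w' ^ (1 / p) * v' ^ (1 / q))
    (hap : w * v ^ (p - 1) ≤ A * x ^ p) :
    v * w / x ≤ A * η ^ (1 - p) * (v' ^ (1 / p) * w' ^ (1 / q)) := by
  have hp0 : 0 < p := by linarith
  have hy0 : 0 < y := lt_of_lt_of_le (by positivity) hy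
  have h1 : v * w ≤ A * x ^ p * v ^ (2 - p) := by
    have : v * w = w * v ^ (p - 1) * v ^ (2 - p) := by
      rw [mul_assoc, ← Real.rpow_add hv, show p - 1 + (2 - p) = 1 by ring, Real.rpow_one, mul_comm]
    rw [this]
    gcongr
  have h2 : v ^ (2 - p) ≤ v' ^ (2 - p) := Real.rpow_le_rpow_of_nonpos hv' hvv (by linarith)
  have h3 : x ^ (p - 1) ≤ η ^ (1 - p) * y ^ (p - 1) := by
    have h4 : x ≤ η⁻¹ * y := by rw [inv_mul_eq_div, le_div_iff₀ hη]; linarith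
    calc x ^ (p - 1) ≤ (η⁻¹ * y) ^ (p - 1) := Real.rpow_le_rpow hx.le h4 (by linarith)
      _ = η ^ (1 - p) * y ^ (p - 1) := by
        rw [Real.mul_rpow (by positivity) hy0.le, Real.inv_rpow hη.le, ← Real.rpow_neg hη.le,
          neg_sub]
  have h5 : y ^ (p - 1) ≤ (w' ^ (1 / p) * v' ^ (1 / q)) ^ (p - 1) :=
    Real.rpow_le_rpow hy0.le hyw (by linarith)
  have hq : 1 / q = 1 - 1 / p := by
    have := hpq.inv_add_inv_eq_one
    rw [one_div, one_div]; linarith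
  have h6 : (w' ^ (1 / p) * v' ^ (1 / q)) ^ (p - 1) * v' ^ (2 - p) =
      v' ^ (1 / p) * w' ^ (1 / q) := by
    rw [Real.mul_rpow (by positivity) (by positivity), ← Real.rpow_mul hw'.le,
      ← Real.rpow_mul hv'.le, mul_assoc, ← Real.rpow_add hv', hq, mul_comm]
    congr 2
    · field_simp; ring
    · field_simp
  have h7 : x ^ p = x ^ (p - 1) * x := by
    nth_rw 3 [← Real.rpow_one x]
    rw [← Real.rpow_add hx, sub_add_cancel]
  rw [div_le_iff₀ hx]
  calc v * w ≤ A * x ^ p * v ^ (2 - p) := h1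
    _ ≤ A * (η ^ (1 - p) * (w' ^ (1 / p) * v' ^ (1 / q)) ^ (p - 1) * x) * v' ^ (2 - p) := by
      rw [h7]
      gcongr
      exact h3.trans (by gcongr)
    _ = A * η ^ (1 - p) * (v' ^ (1 / p) * w' ^ (1 / q)) * x := by rw [← h6]; ring

theorem ap_testing {W V : X → ℝ≥0∞} {p q η : ℝ} (hWV : DualWeights μ p q W V) (hp : 2 ≤ p)
    (hη : 0 < η) {A : ℝ≥0∞} (hA : A ≠ ∞) {s t : Set X} (hts : t ⊆ s) (hs0 : μ s ≠ 0)
    (hs : μ s ≠ ∞) (hst : ENNReal.ofReal η * μ s ≤ μ t)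
    (hap : (⨍⁻ x in s, W x ∂μ) * (⨍⁻ x in s, V x ∂μ) ^ (p - 1) ≤ A) :
    (∫⁻ x in s, V x ∂μ) ≠ ∞ ∧ (∫⁻ x in s, W x ∂μ) ≠ ∞ ∧
    (∫⁻ x in s, V x ∂μ) * (∫⁻ x in s, W x ∂μ) / μ s ≤ A * ENNReal.ofReal (η ^ (1 - p)) *
      ((∫⁻ x in t, V x ∂μ) ^ (1 / p) * (∫⁻ x in t, W x ∂μ) ^ (1 / q)) := by
  have hp0 : 0 < p := by linarith
  have hp1 : 0 < p - 1 := by linarith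
  have hq0 := hWV.conj.symm.pos
  have ht0 : μ t ≠ 0 := fun h0 => by
    rw [h0, le_zero_iff, mul_eq_zero] at hst
    simp [hs0] at hst
    linarith
  have ht : μ t ≠ ∞ := ((measure_mono hts).trans_lt hs.lt_top).ne
  set w := ∫⁻ x in s, W x ∂μ with hw
  set v := ∫⁻ x in s, V x ∂μ with hv
  have hw0 : w ≠ 0 := hWV.lintegral_ne_zero hs0
  have hv0 : v ≠ 0 := hWV.symm.lintegral_ne_zero hs0
  have hap' : w * v ^ (p - 1) ≤ A * μ s ^ p := by
    rw [setLAverage_eq, setLAverage_eq, ENNReal.div_rpow_of_nonneg _ _ hp1.le,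
      ENNReal.div_eq_inv_mul, ENNReal.div_eq_inv_mul] at hap
    have e : w * v ^ (p - 1) =
        ((μ s)⁻¹ * w * ((μ s ^ (p - 1))⁻¹ * v ^ (p - 1))) * (μ s * μ s ^ (p - 1)) := by
      have h1 := ENNReal.inv_mul_cancel hs0 hs
      have h2 : (μ s ^ (p - 1))⁻¹ * μ s ^ (p - 1) = 1 := ENNReal.inv_mul_cancel
        (by simp [ENNReal.rpow_eq_zero_iff, hs0, hs]) (by simp [ENNReal.rpow_eq_top_iff, hs0, hs])
      calc w * v ^ (p - 1) = w * v ^ (p - 1) * ((μ s)⁻¹ * μ s) *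
            ((μ s ^ (p - 1))⁻¹ * μ s ^ (p - 1)) := by rw [h1, h2, mul_one, mul_one]
        _ = _ := by ring
    rw [e]
    have h3 : μ s * μ s ^ (p - 1) = μ s ^ p := by
      nth_rw 1 [← ENNReal.rpow_one (μ s)]
      rw [← ENNReal.rpow_add_of_nonneg _ _ zero_le_one hp1.le, add_sub_cancel]
    rw [h3]
    gcongr
  have hfin : w * v ^ (p - 1) ≠ ∞ :=
    (hap'.trans_lt (ENNReal.mul_lt_top hA.lt_top (ENNReal.rpow_lt_top_of_nonneg hp0.le hs))).ne
  have hwt : w ≠ ∞ := fun h => by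
    rw [h, ENNReal.top_mul (by simp [ENNReal.rpow_eq_zero_iff, hv0, hp1.not_gt])] at hfin
    exact hfin rfl
  have hvt : v ≠ ∞ := fun h => by
    rw [h, ENNReal.top_rpow_of_pos hp1, ENNReal.mul_top hw0] at hfin
    exact hfin rfl
  refine ⟨hvt, hwt, ?_⟩
  set w' := ∫⁻ x in t, W x ∂μ with hw'
  set v' := ∫⁻ x in t, V x ∂μ with hv'
  have hw'0 : w' ≠ 0 := hWV.lintegral_ne_zero ht0
  have hv'0 : v' ≠ 0 := hWV.symm.lintegral_ne_zero ht0
  have hvv : v' ≤ v := lintegral_mono_set hts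
  have hw't : w' ≠ ∞ := ((lintegral_mono_set hts).trans_lt hwt.lt_top).ne
  have hv't : v' ≠ ∞ := (hvv.trans_lt hvt.lt_top).ne
  have hμt := hWV.measure_le t
  have key := ap_testing_real (A := A.toReal) (x := (μ s).toReal) (y := (μ t).toReal)
    (w := w.toReal) (v := v.toReal) (w' := w'.toReal) (v' := v'.toReal) hWV.conj hp hη
    ENNReal.toReal_nonneg (ENNReal.toReal_pos hs0 hs)
    (by
      have := ENNReal.toReal_mono ht hst
      rwa [ENNReal.toReal_mul, ENNReal.toReal_ofReal hη.le] at this)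
    (ENNReal.toReal_pos hw'0 hw't) (ENNReal.toReal_pos hv'0 hv't) (ENNReal.toReal_pos hv0 hvt)
    (ENNReal.toReal_mono hvt hvv)
    (by
      have := ENNReal.toReal_mono (ENNReal.mul_ne_top
        (ENNReal.rpow_ne_top_of_nonneg (by positivity) hw't)
        (ENNReal.rpow_ne_top_of_nonneg (by positivity) hv't)) hμt
      rwa [ENNReal.toReal_mul, ← ENNReal.toReal_rpow, ← ENNReal.toReal_rpow] at this)
    (by
      have := ENNReal.toReal_mono (ENNReal.mul_ne_top hA
        (ENNReal.rpow_ne_top_of_nonneg hp0.le hs)) hap'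
      rwa [ENNReal.toReal_mul, ENNReal.toReal_mul, ← ENNReal.toReal_rpow,
        ← ENNReal.toReal_rpow] at this)
  rw [← ENNReal.toReal_le_toReal (ENNReal.div_ne_top (ENNReal.mul_ne_top hvt hwt) hs0)
    (by
      refine ENNReal.mul_ne_top (ENNReal.mul_ne_top hA ENNReal.ofReal_ne_top)
        (ENNReal.mul_ne_top ?_ ?_) <;>
        exact ENNReal.rpow_ne_top_of_nonneg (by positivity) (by assumption))]
  simp only [ENNReal.toReal_div, ENNReal.toReal_mul, ← ENNReal.toReal_rpow,
    ENNReal.toReal_ofReal (Real.rpow_nonneg hη.le _)]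
  exact key

/-- The constant in the weighted bound for `η`-sparse operators on `L^p` when `2 ≤ p`. -/
def sparseConst (p q η : ℝ) : ℝ≥0∞ :=
  ENNReal.ofReal (η ^ (1 - p)) * (carlesonConst p ^ (1 / p) * carlesonConst q ^ (1 / q))

theorem sparseConst_ne_top (p q η : ℝ) (hp : 0 < p) (hq : 0 < q) : sparseConst p q η ≠ ∞ :=
  ENNReal.mul_ne_top ENNReal.ofReal_ne_top (ENNReal.mul_ne_top
    (ENNReal.rpow_ne_top_of_nonneg (by positivity) (carlesonConst_ne_top p))
    (ENNReal.rpow_ne_top_of_nonneg (by positivity) (carlesonConst_ne_top q)))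

/-- Together with `lintegral_div_rpow`: passing from `h` to `h / V` turns integrals against `μ` into
integrals against `V dμ`, and the norm of `L^p(W)` into that of `L^p(V)`. -/
theorem setLIntegral_eq_lintegral_div {W V : X → ℝ≥0∞} {p q : ℝ} (hWV : DualWeights μ p q W V)
    {h : X → ℝ≥0∞} (hh : Measurable h) {s : Set X} (hs : MeasurableSet s) :
    ∫⁻ x in s, h x / V x ∂(μ.withDensity V) = ∫⁻ x in s, h x ∂μ := by
  have hV := hWV.measurable_right
  rw [restrict_withDensity hs, lintegral_withDensity_eq_lintegral_mul _ hV (g := fun x => h x / V x)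
    (hh.div hV)]
  refine lintegral_congr_ae (ae_restrict_of_ae ?_)
  filter_upwards [hWV.ae_right] with x hx
  exact ENNReal.mul_div_cancel hx.1 hx.2

theorem lintegral_div_rpow {W V : X → ℝ≥0∞} {p q : ℝ} (hWV : DualWeights μ p q W V)
    {h : X → ℝ≥0∞} (hh : Measurable h) :
    ∫⁻ x, (h x / V x) ^ p ∂(μ.withDensity V) = ∫⁻ x, h x ^ p * W x ∂μ := by
  have hV := hWV.measurable_right
  rw [lintegral_withDensity_eq_lintegral_mul _ hV (g := fun x => (h x / V x) ^ p)
    ((hh.div hV).pow_const p)]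
  refine lintegral_congr_ae ?_
  filter_upwards [hWV.symm.ae] with x hx
  have hp := hWV.conj.pos
  simp only [Pi.mul_apply]
  rw [hx.2.2, ENNReal.div_rpow_of_nonneg _ _ hp.le, ENNReal.div_eq_inv_mul, ← ENNReal.rpow_neg,
    ← mul_assoc, mul_comm (h x ^ p)]
  congr 1
  nth_rw 1 [← ENNReal.rpow_one (V x)]
  rw [← ENNReal.rpow_add _ _ hx.1 hx.2.1, sub_eq_add_neg]

/-- The bilinear form of a sparse operator for `2 ≤ p`. Each cube contributes the averages of
`h / V` and of `k / W` with respect to `V dμ` and `W dμ`, times a quantity that the `A_p` condition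
bounds by the measures of the sparse part of the cube; Hölder's inequality and the Carleson
embedding for both measures finish the estimate. -/
theorem IsSparseFamily.lintegral_averagingOp_mul_le_of_two_le [Countable ι] [SFinite μ]
    {W V : X → ℝ≥0∞} {p q η : ℝ} (hSF : IsSparseFamily μ η S F) (hWV : DualWeights μ p q W V)
    (hp : 2 ≤ p) (hη : 0 < η) {A : ℝ≥0∞} (hA : A ≠ ∞)
    (hap : ∀ i, (⨍⁻ x in S i, W x ∂μ) * (⨍⁻ x in S i, V x ∂μ) ^ (p - 1) ≤ A)
    {h k : X → ℝ≥0∞} (hh : Measurable h) (hk : Measurable k) :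
    ∫⁻ x, averagingOp μ S h x * k x ∂μ ≤
      sparseConst p q η * A * weightedNorm μ p W h * weightedNorm μ q V k := by
  have hp0 : 0 < p := by linarith
  have hq0 := hWV.conj.symm.pos
  have hW := hWV.measurable_left
  have hV := hWV.measurable_right
  have hSm := hSF.measurableSet
  set v := μ.withDensity V with hv
  set w := μ.withDensity W with hw
  have hvS : ∀ s, MeasurableSet s → v s = ∫⁻ x in s, V x ∂μ := fun s hs => withDensity_apply _ hs
  have hwS : ∀ s, MeasurableSet s → w s = ∫⁻ x in s, W x ∂μ := fun s hs => withDensity_apply _ hs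
  set a : ι → ℝ≥0∞ := fun i => (∫⁻ x in S i, h x / V x ∂v) / v (S i) with ha
  set b : ι → ℝ≥0∞ := fun i => (∫⁻ x in S i, k x / W x ∂w) / w (S i) with hb
  have hterm : ∀ i, (⨍⁻ y in S i, h y ∂μ) * ∫⁻ y in S i, k y ∂μ ≤
      A * ENNReal.ofReal (η ^ (1 - p)) *
        ((a i * v (F i) ^ (1 / p)) * (b i * w (F i) ^ (1 / q))) := by
    intro i
    obtain ⟨hvt, hwt, ht⟩ := ap_testing hWV hp hη hA (hSF.subset i) (hSF.measure_ne_zero i)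
      (hSF.measure_ne_top i) (hSF.le_measure i) (hap i)
    have hv0 := hWV.symm.lintegral_ne_zero (hSF.measure_ne_zero i)
    have hw0 := hWV.lintegral_ne_zero (hSF.measure_ne_zero i)
    rw [← hvS _ (hSm i)] at hvt hv0 ht
    rw [← hwS _ (hSm i)] at hwt hw0 ht
    rw [← hvS _ (hSF.measurableSet_right i), ← hwS _ (hSF.measurableSet_right i)] at ht
    have e1 : ∫⁻ y in S i, h y ∂μ = a i * v (S i) := by
      rw [ha, ← setLIntegral_eq_lintegral_div hWV hh (hSm i), ENNReal.div_mul_cancel hv0 hvt]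
    have e2 : ∫⁻ y in S i, k y ∂μ = b i * w (S i) := by
      rw [hb, ← setLIntegral_eq_lintegral_div hWV.symm hk (hSm i), ENNReal.div_mul_cancel hw0 hwt]
    rw [setLAverage_eq, e1, e2]
    calc a i * v (S i) / μ (S i) * (b i * w (S i))
        = a i * b i * (v (S i) * w (S i) / μ (S i)) := by
          simp only [ENNReal.div_eq_inv_mul]; ring
      _ ≤ a i * b i * (A * ENNReal.ofReal (η ^ (1 - p)) *
          (v (F i) ^ (1 / p) * w (F i) ^ (1 / q))) := by gcongr
      _ = _ := by ring
  have hF : ∀ (r : ℝ), 0 < r → ∀ (c : ι → ℝ≥0∞) (m : Measure X),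
      ∑' i, (c i * m (F i) ^ (1 / r)) ^ r = ∑' i, c i ^ r * m (F i) := by
    intro r hr c m
    refine tsum_congr fun i => ?_
    rw [ENNReal.mul_rpow_of_nonneg _ _ hr.le, ← ENNReal.rpow_mul, one_div_mul_cancel hr.ne',
      ENNReal.rpow_one]
  have c1 : ∑' i, a i ^ p * v (F i) ≤ carlesonConst p * ∫⁻ x, h x ^ p * W x ∂μ := by
    rw [← lintegral_div_rpow hWV hh]
    exact hSF.nested.tsum_average_rpow_le_of_aemeasurable hSm hSF.measurableSet_right hSF.subset
      hSF.pairwise_disjoint hWV.conj.lt v (hh.div hV).aemeasurable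
  have c2 : ∑' i, b i ^ q * w (F i) ≤ carlesonConst q * ∫⁻ x, k x ^ q * V x ∂μ := by
    rw [← lintegral_div_rpow hWV.symm hk]
    exact hSF.nested.tsum_average_rpow_le_of_aemeasurable hSm hSF.measurableSet_right hSF.subset
      hSF.pairwise_disjoint hWV.conj.symm.lt w (hk.div hW).aemeasurable
  rw [lintegral_averagingOp_mul hSm h hk]
  calc _ ≤ ∑' i, A * ENNReal.ofReal (η ^ (1 - p)) *
        ((a i * v (F i) ^ (1 / p)) * (b i * w (F i) ^ (1 / q))) := ENNReal.tsum_le_tsum hterm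
    _ = A * ENNReal.ofReal (η ^ (1 - p)) *
        ∑' i, (a i * v (F i) ^ (1 / p)) * (b i * w (F i) ^ (1 / q)) := ENNReal.tsum_mul_left
    _ ≤ A * ENNReal.ofReal (η ^ (1 - p)) *
        ((carlesonConst p * ∫⁻ x, h x ^ p * W x ∂μ) ^ (1 / p) *
          (carlesonConst q * ∫⁻ x, k x ^ q * V x ∂μ) ^ (1 / q)) := by
        gcongr
        refine (tsum_mul_le_Lp_mul_Lq hWV.conj _ _).trans ?_
        rw [hF p hp0, hF q hq0]
        gcongr
    _ = _ := by
        rw [ENNReal.mul_rpow_of_nonneg _ _ (by positivity),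
          ENNReal.mul_rpow_of_nonneg _ _ (by positivity), sparseConst, weightedNorm, weightedNorm]
        ring

/-- The constant in the weighted bound for `η`-sparse operators. -/
def weightedSparseConst (p q η : ℝ) : ℝ≥0∞ := sparseConst p q η + sparseConst q p η

theorem weightedSparseConst_ne_top {p : ℝ} (hp : 1 < p) (η : ℝ) :
    weightedSparseConst p (p / (p - 1)) η ≠ ∞ := by
  have hp0 : 0 < p := by linarith
  have hq : 0 < p / (p - 1) := div_pos hp0 (by linarith)
  exact ENNReal.add_ne_top.2 ⟨sparseConst_ne_top _ _ _ hp0 hq, sparseConst_ne_top _ _ _ hq hp0⟩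

theorem IsSparseFamily.lintegral_averagingOp_mul_le [Countable ι] [SFinite μ]
    {W V : X → ℝ≥0∞} {p q η : ℝ} (hSF : IsSparseFamily μ η S F) (hWV : DualWeights μ p q W V)
    (hη : 0 < η) {A : ℝ≥0∞} (hA : A ≠ ∞)
    (hap : ∀ i, (⨍⁻ x in S i, W x ∂μ) * (⨍⁻ x in S i, V x ∂μ) ^ (p - 1) ≤ A)
    {h k : X → ℝ≥0∞} (hh : Measurable h) (hk : Measurable k) :
    ∫⁻ x, averagingOp μ S h x * k x ∂μ ≤
      weightedSparseConst p q η * A ^ max (1 / (p - 1)) 1 *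
        weightedNorm μ p W h * weightedNorm μ q V k := by
  have hp1 := hWV.conj.lt
  rcases le_total 2 p with hp | hp
  · have hmax : max (1 / (p - 1)) 1 = 1 := by
      rw [max_eq_right]; rw [div_le_one (by linarith)]; linarith
    rw [hmax, ENNReal.rpow_one]
    refine (hSF.lintegral_averagingOp_mul_le_of_two_le hWV hp hη hA hap hh hk).trans ?_
    gcongr
    exact le_self_add
  · -- For `p ≤ 2` the conjugate exponent is at least `2` and the form is symmetric in `h` and `k`.
    have hmax : max (1 / (p - 1)) 1 = 1 / (p - 1) := by
      rw [max_eq_left]; rw [le_div_iff₀ (by linarith)]; linarith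
    have hq : q = p / (p - 1) := hWV.conj.conjugate_eq
    have hq2 : 2 ≤ q := by rw [hq, le_div_iff₀ (by linarith)]; linarith
    have hq1 : q - 1 = 1 / (p - 1) := by
      have : p - 1 ≠ 0 := by linarith
      rw [hq]; field_simp; ring
    have hA' : A ^ (1 / (p - 1)) ≠ ∞ :=
      ENNReal.rpow_ne_top_of_nonneg (by rw [← hq1]; linarith) hA
    have hap' : ∀ i, (⨍⁻ x in S i, V x ∂μ) * (⨍⁻ x in S i, W x ∂μ) ^ (q - 1) ≤
        A ^ (1 / (p - 1)) := by
      intro i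
      refine le_trans (le_of_eq ?_) (ENNReal.rpow_le_rpow (hap i) (by rw [← hq1]; linarith))
      rw [ENNReal.mul_rpow_of_nonneg _ _ (by rw [← hq1]; linarith), ← ENNReal.rpow_mul,
        mul_one_div_cancel (by linarith), ENNReal.rpow_one, hq1, mul_comm]
    rw [hmax, lintegral_averagingOp_mul_comm hSF.measurableSet hh hk]
    refine (hSF.lintegral_averagingOp_mul_le_of_two_le hWV.symm hq2 hη hA' hap' hk hh).trans ?_
    rw [mul_right_comm]
    gcongr
    exact le_add_self

/-- Sparse operators are bounded on `L^p(W)` with the sharp dependence on the `A_p`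
characteristic. -/
theorem IsSparseFamily.weightedNorm_averagingOp_le [Countable ι] [SigmaFinite μ]
    {W V : X → ℝ≥0∞} {p q η : ℝ} (hSF : IsSparseFamily μ η S F) (hWV : DualWeights μ p q W V)
    (hη : 0 < η) {A : ℝ≥0∞} (hA : A ≠ ∞)
    (hap : ∀ i, (⨍⁻ x in S i, W x ∂μ) * (⨍⁻ x in S i, V x ∂μ) ^ (p - 1) ≤ A)
    {h : X → ℝ≥0∞} (hh : Measurable h) :
    weightedNorm μ p W (averagingOp μ S h) ≤
      weightedSparseConst p q η * A ^ max (1 / (p - 1)) 1 * weightedNorm μ p W h :=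
  hWV.weightedNorm_le_of_forall (measurable_averagingOp hSF.measurableSet h) fun _ hk =>
    hSF.lintegral_averagingOp_mul_le hWV hη hA hap hh hk

/-- Sparse operators are self-adjoint, so the bound on `L^p(W)` gives one on `L^q(V)` for the dual
weight. -/
theorem IsSparseFamily.weightedNorm_averagingOp_le_dual [Countable ι] [SigmaFinite μ]
    {W V : X → ℝ≥0∞} {p q η : ℝ} (hSF : IsSparseFamily μ η S F) (hWV : DualWeights μ p q W V)
    (hη : 0 < η) {A : ℝ≥0∞} (hA : A ≠ ∞)
    (hap : ∀ i, (⨍⁻ x in S i, W x ∂μ) * (⨍⁻ x in S i, V x ∂μ) ^ (p - 1) ≤ A)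
    {k : X → ℝ≥0∞} (hk : Measurable k) :
    weightedNorm μ q V (averagingOp μ S k) ≤
      weightedSparseConst p q η * A ^ max (1 / (p - 1)) 1 * weightedNorm μ q V k := by
  refine hWV.symm.weightedNorm_le_of_forall (measurable_averagingOp hSF.measurableSet k)
    fun h hh => ?_
  rw [lintegral_averagingOp_mul_comm hSF.measurableSet hk hh, mul_right_comm]
  exact hSF.lintegral_averagingOp_mul_le hWV hη hA hap hh hk

end Sparse

/-! ### Oscillation over nested partitions -/

section Oscillation

variable {X : Type*} [MeasurableSpace X] {μ : Measure X}

theorem enorm_average_sub_le {b : X → ℝ} {s : Set X} (hs0 : μ s ≠ 0) (hs : μ s ≠ ∞)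
    (hb : IntegrableOn b s μ) (c : ℝ) :
    ‖(⨍ y in s, b y ∂μ) - c‖ₑ ≤ ⨍⁻ y in s, ‖b y - c‖ₑ ∂μ := by
  have : NeZero (μ.restrict s) := ⟨by simpa [Measure.restrict_eq_zero] using hs0⟩
  have : IsFiniteMeasure (μ.restrict s) := ⟨by simpa using hs.lt_top⟩
  have hb' : Integrable b (((μ.restrict s) Set.univ)⁻¹ • μ.restrict s) :=
    hb.smul_measure (by simp [hs0])
  have e : (⨍ y in s, b y ∂μ) - c = ⨍ y in s, (b y - c) ∂μ := by
    have h1 : μ.real s ≠ 0 := (ENNReal.toReal_pos hs0 hs).ne'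
    rw [average, average, integral_sub hb' (integrable_const c), integral_const]
    simp [← measureReal_def, h1]
  rw [e]
  exact enorm_integral_le_lintegral_enorm _

/-- The sets `Q n x` are, for each `n`, the cells of a countable measurable partition of the space,
`Q n x` being the cell containing `x`. The partitions become finer as `n` grows, shrink to points,
and the measure of a cell is at most `D` times that of each of its subcells in the next
partition. -/
structure NestedPartitions [TopologicalSpace X] (μ : Measure X) (D : ℝ≥0∞)
    (Q : ℕ → X → Set X) : Prop where
  mem : ∀ n x, x ∈ Q n x
  eq_of_mem : ∀ n x y, y ∈ Q n x → Q n y = Q n x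
  succ_subset : ∀ n x, Q (n + 1) x ⊆ Q n x
  measurableSet : ∀ n x, MeasurableSet (Q n x)
  countable : ∀ n, (Set.range (Q n)).Countable
  measure_ne_zero : ∀ n x, μ (Q n x) ≠ 0
  measure_ne_top : ∀ n x, μ (Q n x) ≠ ∞
  measure_le : ∀ n x, μ (Q n x) ≤ D * μ (Q (n + 1) x)
  exists_subset : ∀ O : Set X, IsOpen O → ∀ x ∈ O, ∃ n, Q n x ⊆ O

/-- The stopping-time construction: `anchor n x` is the last selected one of the cells
`Q 0 x, …, Q n x`, where `Q 0 x` is selected, and `Q (n + 1) x` is selected if the mean distance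
over it from `b` to the average of `b` over the previously selected cell exceeds `l`. -/
def anchor (μ : Measure X) (Q : ℕ → X → Set X) (b : X → ℝ) (l : ℝ≥0∞) : ℕ → X → Set X
  | 0, x => Q 0 x
  | n + 1, x =>
    open Classical in
    if l < ⨍⁻ y in Q (n + 1) x, ‖b y - ⨍ z in anchor μ Q b l n x, b z ∂μ‖ₑ ∂μ
      then Q (n + 1) x else anchor μ Q b l n x

/-- The family of all selected cells. -/
def anchorFamily (μ : Measure X) (Q : ℕ → X → Set X) (b : X → ℝ) (l : ℝ≥0∞) : Set (Set X) :=
  {S | ∃ n x, anchor μ Q b l n x = S}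

/-- The set of points for which `S` is the last selected cell. -/
def lastAnchor (μ : Measure X) (Q : ℕ → X → Set X) (b : X → ℝ) (l : ℝ≥0∞) (S : Set X) : Set X :=
  {y | ∃ m, ∀ n, m ≤ n → anchor μ Q b l n y = S}

section Anchor

variable {Q : ℕ → X → Set X} {b : X → ℝ} {l : ℝ≥0∞}

theorem exists_anchor_eq (n : ℕ) (x : X) :
    ∃ m, m ≤ n ∧ anchor μ Q b l n x = Q m x ∧ anchor μ Q b l m x = Q m x := by
  induction n with
  | zero => exact ⟨0, le_rfl, rfl, rfl⟩
  | succ n ih =>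
    by_cases hc : l < ⨍⁻ y in Q (n + 1) x, ‖b y - ⨍ z in anchor μ Q b l n x, b z ∂μ‖ₑ ∂μ
    · have : anchor μ Q b l (n + 1) x = Q (n + 1) x := by rw [anchor, if_pos hc]
      exact ⟨n + 1, le_rfl, this, this⟩
    · have : anchor μ Q b l (n + 1) x = anchor μ Q b l n x := by rw [anchor, if_neg hc]
      obtain ⟨m, hm, h1, h2⟩ := ih
      exact ⟨m, hm.trans n.le_succ, this.trans h1, h2⟩

theorem exists_eq_of_mem_anchorFamily {S : Set X} (hS : S ∈ anchorFamily μ Q b l) :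
    ∃ n x, S = Q n x := by
  obtain ⟨n, x, rfl⟩ := hS
  obtain ⟨m, _, hm, _⟩ := exists_anchor_eq (μ := μ) (Q := Q) (b := b) (l := l) n x
  exact ⟨m, x, hm⟩

theorem average_anchor_le {ε : ℝ≥0∞} (hε : ε ≤ l)
    (hosc : ∀ n x, ⨍⁻ y in Q n x, ‖b y - ⨍ z in Q n x, b z ∂μ‖ₑ ∂μ ≤ ε) (n : ℕ) (x : X) :
    ⨍⁻ y in Q n x, ‖b y - ⨍ z in anchor μ Q b l n x, b z ∂μ‖ₑ ∂μ ≤ l := by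
  cases n with
  | zero => exact (hosc 0 x).trans hε
  | succ n =>
    rw [anchor]
    split_ifs with hc
    · exact (hosc _ x).trans hε
    · exact not_lt.1 hc

end Anchor

namespace NestedPartitions

variable [TopologicalSpace X] {D : ℝ≥0∞} {Q : ℕ → X → Set X}

theorem subset_of_le (h : NestedPartitions μ D Q) {m n : ℕ} (hmn : m ≤ n) (x : X) :
    Q n x ⊆ Q m x := by
  induction n, hmn using Nat.le_induction with
  | base => exact subset_rfl
  | succ n _ ih => exact (h.succ_subset n x).trans ih

theorem subset_or_disjoint (h : NestedPartitions μ D Q) {m n : ℕ} (hmn : m ≤ n) (x y : X) :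
    Q n x ⊆ Q m y ∨ Disjoint (Q n x) (Q m y) := by
  by_cases hd : Disjoint (Q n x) (Q m y)
  · exact Or.inr hd
  · obtain ⟨z, hzx, hzy⟩ := Set.not_disjoint_iff.1 hd
    left
    rw [← h.eq_of_mem n x z hzx, ← h.eq_of_mem m y z hzy]
    exact h.subset_of_le hmn z

theorem isNestedFamily (h : NestedPartitions μ D Q) {T : Set (Set X)}
    (hT : ∀ S ∈ T, ∃ n x, S = Q n x) : IsNestedFamily fun S : T => (S : Set X) := by
  rintro ⟨R, hR⟩ ⟨S, hS⟩
  obtain ⟨m, x, rfl⟩ := hT R hR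
  obtain ⟨n, y, rfl⟩ := hT S hS
  rcases le_total m n with hmn | hmn
  · rcases h.subset_or_disjoint hmn y x with h1 | h1
    · exact Or.inr (Or.inl h1)
    · exact Or.inr (Or.inr h1.symm)
  · rcases h.subset_or_disjoint hmn x y with h1 | h1
    · exact Or.inl h1
    · exact Or.inr (Or.inr h1)

theorem countable_of_forall (h : NestedPartitions μ D Q) {T : Set (Set X)}
    (hT : ∀ S ∈ T, ∃ n x, S = Q n x) : T.Countable := by
  refine (Set.countable_iUnion h.countable).mono fun S hS => ?_
  obtain ⟨n, x, rfl⟩ := hT S hS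
  exact Set.mem_iUnion.2 ⟨n, x, rfl⟩

theorem measurableSet_of_forall (h : NestedPartitions μ D Q) {A : Set X} (n : ℕ)
    (hA : ∀ x ∈ A, Q n x ⊆ A) : MeasurableSet A := by
  have : A = ⋃₀ (Q n '' A) := by
    apply Set.Subset.antisymm
    · exact fun x hx => ⟨Q n x, ⟨x, hx, rfl⟩, h.mem n x⟩
    · rintro y ⟨_, ⟨x, hx, rfl⟩, hy⟩
      exact hA x hx hy
  rw [this]
  refine MeasurableSet.sUnion ((h.countable n).mono (Set.image_subset_range _ _)) ?_
  rintro _ ⟨x, _, rfl⟩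
  exact h.measurableSet n x

/-- The differentiation property of the partitions: if the averages of `g` over the cells containing
`x` are eventually at most `l`, then `g x ≤ l`, for almost every `x`. By outer regularity, the set
where this fails is covered up to a small error by cells on which the average is at most `l`. -/
theorem ae_le_of_forall_average_le [BorelSpace X] [μ.OuterRegular] [SFinite μ]
    (h : NestedPartitions μ D Q)
    {g : X → ℝ≥0∞} (hg : Measurable g) {l : ℝ≥0∞} (hl0 : l ≠ 0) (hl : l ≠ ∞) :
    ∀ᵐ x ∂μ, ∀ m, (∀ n, m ≤ n → ⨍⁻ y in Q n x, g y ∂μ ≤ l) → g x ≤ l := by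
  rw [ae_all_iff]
  intro m
  set E : Set X := {x | ∀ n, m ≤ n → ⨍⁻ y in Q n x, g y ∂μ ≤ l} with hE
  have hEm : MeasurableSet E := by
    have : E = ⋂ n, ⋂ (_ : m ≤ n), {x | ⨍⁻ y in Q n x, g y ∂μ ≤ l} := by ext; simp [hE]
    rw [this]
    refine MeasurableSet.iInter fun n => MeasurableSet.iInter fun _ =>
      h.measurableSet_of_forall n fun x hx y hy => ?_
    change ⨍⁻ y in Q n y, g y ∂μ ≤ l
    rw [h.eq_of_mem n x y hy]
    exact hx
  -- On any part `A` of the exceptional set, the integral of `g` is at most `l * μ O`.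
  have key : ∀ A ⊆ E, ∀ O, IsOpen O → A ⊆ O → ∫⁻ x in A, g x ∂μ ≤ l * μ O := by
    intro A hA O hO hAO
    set R : Set (Set X) := {S | (∃ n x, S = Q n x) ∧ ∫⁻ x in S, g x ∂μ ≤ l * μ S ∧ S ⊆ O} with hR
    have hRQ : ∀ S ∈ R, ∃ n x, S = Q n x := fun S hS => hS.1
    have : Countable R := (h.countable_of_forall hRQ).to_subtype
    have hRm : ∀ S : R, MeasurableSet (S : Set X) := fun S => by
      obtain ⟨n, x, hS⟩ := hRQ S S.2
      rw [hS]; exact h.measurableSet n x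
    have := (h.isNestedFamily hRQ).measure_iUnion_le hRm (μ := μ.withDensity g) (ν := l • μ)
      fun S => by
        rw [withDensity_apply _ (hRm S), Measure.smul_apply, smul_eq_mul]
        exact S.2.2.1
    rw [withDensity_apply _ (MeasurableSet.iUnion hRm), Measure.smul_apply, smul_eq_mul] at this
    have hsub : A ⊆ ⋃ S : R, (S : Set X) := by
      intro x hx
      obtain ⟨n, hn⟩ := h.exists_subset O hO x (hAO hx)
      refine Set.mem_iUnion.2 ⟨⟨Q (max m n) x, ⟨⟨_, _, rfl⟩, ?_, ?_⟩⟩, h.mem _ x⟩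
      · have := hA hx (max m n) (le_max_left _ _)
        rwa [setLAverage_eq, ENNReal.div_le_iff (h.measure_ne_zero _ _) (h.measure_ne_top _ _)]
          at this
      · exact (h.subset_of_le (le_max_right m n) x).trans hn
    refine (lintegral_mono_set hsub).trans (this.trans ?_)
    gcongr
    exact Set.iUnion_subset fun S => S.2.2.2
  rw [ae_iff]
  have hset : {x | ¬((∀ n, m ≤ n → ⨍⁻ y in Q n x, g y ∂μ ≤ l) → g x ≤ l)} = E ∩ {x | l < g x} := by
    ext x; simp [hE]
  rw [hset]
  have hBm : MeasurableSet (E ∩ {x | l < g x}) :=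
    hEm.inter (measurableSet_lt measurable_const hg)
  have hcov : (⋃ S : Set.range (Q 0), (E ∩ {x | l < g x}) ∩ (S : Set X)) = E ∩ {x | l < g x} := by
    rw [← Set.inter_iUnion]
    refine Set.inter_eq_left.2 fun x _ => Set.mem_iUnion.2 ⟨⟨Q 0 x, x, rfl⟩, h.mem 0 x⟩
  have : Countable (Set.range (Q 0)) := (h.countable 0).to_subtype
  rw [← hcov, measure_iUnion_null_iff]
  rintro ⟨_, x, rfl⟩
  by_contra hne
  set B := (E ∩ {x | l < g x}) ∩ Q 0 x with hB
  have hBfin : μ B ≠ ∞ :=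
    ((measure_mono Set.inter_subset_right).trans_lt (h.measure_ne_top 0 x).lt_top).ne
  have hBm' : MeasurableSet B := hBm.inter (h.measurableSet 0 x)
  have hlt : l * μ B < ∫⁻ x in B, g x ∂μ := by
    rw [← setLIntegral_const]
    exact setLIntegral_strict_mono hBm' hne hg
      (by rw [setLIntegral_const]; exact ENNReal.mul_ne_top hl hBfin)
      (ae_of_all _ fun x hx => hx.1.2)
  have hlt' : μ B < (∫⁻ x in B, g x ∂μ) / l := by
    rw [ENNReal.lt_div_iff_mul_lt (Or.inl hl0) (Or.inl hl), mul_comm]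
    exact hlt
  obtain ⟨O, hBO, hO, hOlt⟩ := B.exists_isOpen_lt_of_lt _ hlt'
  rw [ENNReal.lt_div_iff_mul_lt (Or.inl hl0) (Or.inl hl), mul_comm] at hOlt
  exact (key B (fun x hx => hx.1.1) O hO hBO).not_gt hOlt

section Anchor

variable {b : X → ℝ} {l : ℝ≥0∞}

theorem anchor_eq_of_mem (h : NestedPartitions μ D Q) {n : ℕ} {x y : X} (hy : y ∈ Q n x) :
    anchor μ Q b l n y = anchor μ Q b l n x := by
  induction n with
  | zero => exact h.eq_of_mem 0 x y hy
  | succ n ih =>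
    rw [anchor, anchor, h.eq_of_mem _ x y hy, ih (h.succ_subset n x hy)]

theorem subset_anchor (h : NestedPartitions μ D Q) (n : ℕ) (x : X) :
    Q n x ⊆ anchor μ Q b l n x := by
  induction n with
  | zero => exact subset_rfl
  | succ n ih =>
    rw [anchor]
    split_ifs
    · exact subset_rfl
    · exact (h.succ_subset n x).trans ih

theorem anchor_succ_subset (h : NestedPartitions μ D Q) (n : ℕ) (x : X) :
    anchor μ Q b l (n + 1) x ⊆ anchor μ Q b l n x := by
  rw [anchor]
  split_ifs
  · exact (h.succ_subset n x).trans (h.subset_anchor n x)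
  · exact subset_rfl

theorem anchor_subset_of_le (h : NestedPartitions μ D Q) {m n : ℕ} (hmn : m ≤ n) (x : X) :
    anchor μ Q b l n x ⊆ anchor μ Q b l m x := by
  induction n, hmn using Nat.le_induction with
  | base => exact subset_rfl
  | succ n _ ih => exact (h.anchor_succ_subset n x).trans ih

/-- Averages over consecutive selected cells differ little, because the cell one step before a
selected one is not selected. -/
theorem enorm_average_anchor_sub_le (h : NestedPartitions μ D Q)
    (hb : ∀ n x, IntegrableOn b (Q n x) μ) {ε : ℝ≥0∞} (hε : ε ≤ l)
    (hosc : ∀ n x, ⨍⁻ y in Q n x, ‖b y - ⨍ z in Q n x, b z ∂μ‖ₑ ∂μ ≤ ε) (n : ℕ) (x : X)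
    (hne : anchor μ Q b l (n + 1) x ≠ anchor μ Q b l n x) :
    anchor μ Q b l (n + 1) x = Q (n + 1) x ∧
    ‖(⨍ z in anchor μ Q b l (n + 1) x, b z ∂μ) - ⨍ z in anchor μ Q b l n x, b z ∂μ‖ₑ ≤ D * l := by
  have he : anchor μ Q b l (n + 1) x = Q (n + 1) x := by
    rw [anchor] at hne ⊢
    split_ifs at hne ⊢ with hc
    · rfl
    · exact absurd rfl hne
  refine ⟨he, ?_⟩
  set c := ⨍ z in anchor μ Q b l n x, b z ∂μ with hc
  rw [he]
  have h0 := h.measure_ne_zero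
  have ht := h.measure_ne_top
  refine (enorm_average_sub_le (h0 _ _) (ht _ _) (hb _ _) c).trans ?_
  have h1 := average_anchor_le (b := b) hε hosc n x
  rw [setLAverage_eq, ENNReal.div_le_iff (h0 _ _) (ht _ _)] at h1
  rw [setLAverage_eq, ENNReal.div_le_iff (h0 _ _) (ht _ _)]
  calc ∫⁻ y in Q (n + 1) x, ‖b y - c‖ₑ ∂μ ≤ ∫⁻ y in Q n x, ‖b y - c‖ₑ ∂μ :=
        lintegral_mono_set (h.succ_subset n x)
    _ ≤ l * (D * μ (Q (n + 1) x)) := h1.trans (by gcongr; exact h.measure_le n x)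
    _ = D * l * μ (Q (n + 1) x) := by ring

theorem measurableSet_lastAnchor (h : NestedPartitions μ D Q) (S : Set X) :
    MeasurableSet (lastAnchor μ Q b l S) := by
  have : lastAnchor μ Q b l S = ⋃ m, ⋂ n, ⋂ (_ : m ≤ n), {y | anchor μ Q b l n y = S} := by
    ext; simp [lastAnchor]
  rw [this]
  refine MeasurableSet.iUnion fun m => MeasurableSet.iInter fun n => MeasurableSet.iInter fun _ =>
    h.measurableSet_of_forall n fun x hx y hy => ?_
  exact (h.anchor_eq_of_mem hy).trans hx

/-- The selected cells form a sparse family: inside a selected cell `S`, the weak-type inequality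
for `|b - b_S|` bounds the total measure of the cells selected next by half the measure of `S`. -/
theorem isSparseFamily_anchorFamily (h : NestedPartitions μ D Q) {ε : ℝ≥0∞} (hε0 : ε ≠ 0)
    (hε : ε ≠ ∞) (hosc : ∀ n x, ⨍⁻ y in Q n x, ‖b y - ⨍ z in Q n x, b z ∂μ‖ₑ ∂μ ≤ ε) :
    IsSparseFamily μ (1 / 2) (fun S : anchorFamily μ Q b (2 * ε) => (S : Set X))
      (fun S => lastAnchor μ Q b (2 * ε) S) where
  nested := h.isNestedFamily fun S hS => exists_eq_of_mem_anchorFamily hS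
  measurableSet S := by
    obtain ⟨n, x, hS⟩ := exists_eq_of_mem_anchorFamily S.2
    rw [hS]; exact h.measurableSet n x
  measure_ne_zero S := by
    obtain ⟨n, x, hS⟩ := exists_eq_of_mem_anchorFamily S.2
    rw [hS]; exact h.measure_ne_zero n x
  measure_ne_top S := by
    obtain ⟨n, x, hS⟩ := exists_eq_of_mem_anchorFamily S.2
    rw [hS]; exact h.measure_ne_top n x
  measurableSet_right S := h.measurableSet_lastAnchor S
  subset S := by
    rintro y ⟨m, hm⟩
    rw [← hm m le_rfl]
    exact h.subset_anchor m y (h.mem m y)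
  pairwise_disjoint R S hRS := by
    refine Set.disjoint_left.2 ?_
    rintro y ⟨m, hm⟩ ⟨n, hn⟩
    refine hRS (Subtype.ext ?_)
    rw [← hm (max m n) (le_max_left _ _), ← hn (max m n) (le_max_right _ _)]
  le_measure := by
    rintro ⟨_, n, x, rfl⟩
    obtain ⟨m, _, hm, hm'⟩ := exists_anchor_eq (μ := μ) (Q := Q) (b := b) (l := 2 * ε) n x
    simp only [hm]
    set S := Q m x with hS
    set c := ⨍ z in S, b z ∂μ with hc
    have hl0 : 2 * ε ≠ 0 := by simp [hε0]
    have hl : 2 * ε ≠ ∞ := ENNReal.mul_ne_top (by simp) hε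
    set R : Set (Set X) := {P | (∃ n x, P = Q n x) ∧
      2 * ε < ⨍⁻ y in P, ‖b y - c‖ₑ ∂μ ∧ P ⊆ S} with hR
    have hRQ : ∀ P ∈ R, ∃ n x, P = Q n x := fun P hP => hP.1
    have : Countable R := (h.countable_of_forall hRQ).to_subtype
    have hRm : ∀ P : R, MeasurableSet (P : Set X) := fun P => by
      obtain ⟨n, x, hP⟩ := hRQ P P.2
      rw [hP]; exact h.measurableSet n x
    have key := (h.isNestedFamily hRQ).measure_iUnion_le hRm (μ := (2 * ε) • μ)
      (ν := μ.withDensity fun y => ‖b y - c‖ₑ) fun P => by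
        rw [withDensity_apply _ (hRm P), Measure.smul_apply, smul_eq_mul]
        refine ENNReal.mul_le_of_le_div ?_
        rw [← setLAverage_eq]
        exact P.2.2.1.le
    rw [withDensity_apply _ (MeasurableSet.iUnion hRm), Measure.smul_apply, smul_eq_mul] at key
    have hRS : (⋃ P : R, (P : Set X)) ⊆ S := Set.iUnion_subset fun P => P.2.2.2
    have h1 : 2 * ε * μ (⋃ P : R, (P : Set X)) ≤ ε * μ S := by
      refine key.trans ((lintegral_mono_set hRS).trans ?_)
      have := hosc m x
      rwa [setLAverage_eq, ENNReal.div_le_iff (h.measure_ne_zero _ _) (h.measure_ne_top _ _)]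
        at this
    have h2 : 2 * μ (⋃ P : R, (P : Set X)) ≤ μ S := by
      rw [mul_comm 2 ε, mul_assoc] at h1
      exact (ENNReal.mul_le_mul_iff_right hε0 hε).1 h1
    have h3 : S ⊆ lastAnchor μ Q b (2 * ε) S ∪ ⋃ P : R, (P : Set X) := by
      intro y hy
      by_cases hyR : y ∈ ⋃ P : R, (P : Set X)
      · exact Or.inr hyR
      refine Or.inl ⟨m, fun k hk => ?_⟩
      induction k, hk using Nat.le_induction with
      | base => exact (h.anchor_eq_of_mem hy).trans hm'
      | succ k hk ih =>
        rw [anchor, ih, if_neg]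
        intro hlt
        refine hyR (Set.mem_iUnion.2 ⟨⟨Q (k + 1) y, ⟨_, _, rfl⟩, hlt, ?_⟩, h.mem _ y⟩)
        rw [hS, ← h.eq_of_mem m x y hy]
        exact h.subset_of_le (by omega) y
    have h4 : μ S ≤ μ (lastAnchor μ Q b (2 * ε) S) + μ (⋃ P : R, (P : Set X)) :=
      (measure_mono h3).trans (measure_union_le _ _)
    have hSt : μ S ≠ ∞ := h.measure_ne_top m x
    have h5 : 2 * μ S ≤ 2 * μ (lastAnchor μ Q b (2 * ε) S) + μ S := by
      calc 2 * μ S ≤ 2 * (μ (lastAnchor μ Q b (2 * ε) S) + μ (⋃ P : R, (P : Set X))) := by gcongr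
        _ = 2 * μ (lastAnchor μ Q b (2 * ε) S) + 2 * μ (⋃ P : R, (P : Set X)) := by ring
        _ ≤ _ := by gcongr
    rw [two_mul (μ S)] at h5
    have h6 := (ENNReal.add_le_add_iff_right hSt).1 h5
    rw [one_div, ENNReal.ofReal_inv_of_pos two_pos, ENNReal.ofReal_ofNat, ← ENNReal.div_eq_inv_mul]
    exact ENNReal.div_le_of_le_mul' h6

/-- Bound for `b` minus its average over a cell `P`, in terms of the number of the selected cells
inside `P`: from the cell selected last before `P` downwards, the averages of `b` change by at most
`2 * D * ε` at each newly selected cell, and after the last one `b` itself is within `2 * ε`. -/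
theorem ae_enorm_sub_average_le [BorelSpace X] [μ.OuterRegular] [SFinite μ]
    (h : NestedPartitions μ D Q) (hbm : Measurable b)
    (hb : ∀ n x, IntegrableOn b (Q n x) μ) {ε : ℝ≥0∞} (hD : D ≠ 0) (hε0 : ε ≠ 0) (hε : ε ≠ ∞)
    (hosc : ∀ n x, ⨍⁻ y in Q n x, ‖b y - ⨍ z in Q n x, b z ∂μ‖ₑ ∂μ ≤ ε) :
    ∀ᵐ y ∂μ, ∀ n, ‖b y - ⨍ z in Q n y, b z ∂μ‖ₑ ≤ 4 * ε + 2 * D * ε *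
      ∑' S : {S : anchorFamily μ Q b (2 * ε) // (S : Set X) ⊆ Q n y},
        (S : Set X).indicator (fun _ => 1) y := by
  have hl0 : 2 * ε ≠ 0 := by simp [hε0]
  have hl : 2 * ε ≠ ∞ := ENNReal.mul_ne_top (by simp) hε
  have hle : ε ≤ 2 * ε := by rw [two_mul]; exact le_self_add
  have : Countable (anchorFamily μ Q b (2 * ε)) :=
    (h.countable_of_forall fun S hS => exists_eq_of_mem_anchorFamily hS).to_subtype
  have hdiff : ∀ᵐ y ∂μ, ∀ S : anchorFamily μ Q b (2 * ε), ∀ m,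
      (∀ n, m ≤ n → ⨍⁻ x in Q n y, ‖b x - ⨍ z in S, b z ∂μ‖ₑ ∂μ ≤ 2 * ε) →
        ‖b y - ⨍ z in S, b z ∂μ‖ₑ ≤ 2 * ε :=
    ae_all_iff.2 fun S => h.ae_le_of_forall_average_le (by fun_prop) hl0 hl
  filter_upwards [hdiff] with y hy n
  set a : ℕ → Set X := fun j => anchor μ Q b (2 * ε) (n + j) y with ha
  set avg : Set X → ℝ := fun S => ⨍ z in S, b z ∂μ with havg
  set N : ℝ≥0∞ := ∑' S : {S : anchorFamily μ Q b (2 * ε) // (S : Set X) ⊆ Q n y},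
        (S : Set X).indicator (fun _ => 1) y with hN
  have hstep : ∀ j, a (j + 1) ≠ a j → a (j + 1) = Q (n + j + 1) y ∧
      ‖avg (a (j + 1)) - avg (a j)‖ₑ ≤ D * (2 * ε) := fun j hj =>
    h.enorm_average_anchor_sub_le hb hle hosc (n + j) y hj
  set J : Set ℕ := {j | a (j + 1) ≠ a j} with hJ
  -- Distinct steps select distinct cells inside `Q n y`, all containing `y`.
  have hcount : ∑' _ : J, (1 : ℝ≥0∞) ≤ N := by
    let φ : J → {S : anchorFamily μ Q b (2 * ε) // (S : Set X) ⊆ Q n y} := fun j =>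
      ⟨⟨a (j + 1), _, _, rfl⟩, by
        change a (j + 1) ⊆ Q n y
        rw [(hstep j j.2).1]
        exact h.subset_of_le (by omega) y⟩
    have hφ : Function.Injective φ := by
      have hlt : ∀ i j : J, (i : ℕ) < j → φ i ≠ φ j := by
        intro i j hij he
        have he' : a (i + 1) = a (j + 1) := congrArg (fun S => ((S.1 : anchorFamily μ Q b (2 * ε)) :
          Set X)) he
        refine j.2 (Set.Subset.antisymm (h.anchor_succ_subset (n + j) y) ?_)
        rw [← he']
        exact h.anchor_subset_of_le (by omega) y
      intro i j he
      rcases lt_trichotomy (i : ℕ) j with hij | hij | hij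
      · exact absurd he (hlt i j hij)
      · exact Subtype.ext hij
      · exact absurd he.symm (hlt j i hij)
    have hone : ∀ j : J, (1 : ℝ≥0∞) = ((φ j).1 : Set X).indicator (fun _ => 1) y := by
      intro j
      have : y ∈ ((φ j).1 : Set X) := h.subset_anchor _ y (h.mem _ y)
      rw [Set.indicator_of_mem this]
    rw [tsum_congr hone]
    exact ENNReal.tsum_comp_le_tsum_of_injective hφ
      (fun S => (S.1 : Set X).indicator (fun _ => (1 : ℝ≥0∞)) y)
  rcases eq_or_ne N ∞ with hNt | hNt
  · rw [hNt, ENNReal.mul_top (by simp [hD, hε0])]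
    simp
  have hJfin : J.Finite := by
    by_contra hinf
    have : Infinite J := Set.infinite_coe_iff.2 hinf
    rw [ENNReal.tsum_const_eq_top_of_ne_zero one_ne_zero] at hcount
    exact hNt (top_le_iff.1 hcount)
  have hsum : ∀ k, ‖avg (a k) - avg (a 0)‖ₑ ≤
      D * (2 * ε) * ∑ j ∈ Finset.range k, J.indicator (fun _ => 1) j := by
    intro k
    induction k with
    | zero => simp
    | succ k ih =>
      rw [Finset.sum_range_succ, mul_add]
      have htri : ‖avg (a (k + 1)) - avg (a 0)‖ₑ ≤
          ‖avg (a k) - avg (a 0)‖ₑ + ‖avg (a (k + 1)) - avg (a k)‖ₑ := by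
        have : avg (a (k + 1)) - avg (a 0) =
          (avg (a k) - avg (a 0)) + (avg (a (k + 1)) - avg (a k)) := by ring
        rw [this]
        exact enorm_add_le _ _
      refine htri.trans (add_le_add ih ?_)
      by_cases hk : a (k + 1) = a k
      · simp [hk]
      · rw [Set.indicator_of_mem (show k ∈ J from hk), mul_one]
        exact (hstep k hk).2
  have hsumN : ∀ k, ‖avg (a k) - avg (a 0)‖ₑ ≤ D * (2 * ε) * N := by
    intro k
    refine (hsum k).trans ?_
    gcongr
    refine (ENNReal.sum_le_tsum _).trans ?_
    rw [← tsum_subtype]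
    exact hcount
  obtain ⟨k, hk⟩ := hJfin.bddAbove
  have hconst : ∀ j, k + 1 ≤ j → a j = a (k + 1) := by
    intro j hj
    induction j, hj using Nat.le_induction with
    | base => rfl
    | succ j hj ih =>
      rw [← ih]
      by_contra hne
      have := hk (show j ∈ J from hne)
      omega
  have h1 : ‖b y - avg (a (k + 1))‖ₑ ≤ 2 * ε := by
    refine hy ⟨a (k + 1), _, _, rfl⟩ (n + (k + 1)) fun m hm => ?_
    have := average_anchor_le (b := b) hle hosc m y
    obtain ⟨j, rfl⟩ := Nat.exists_eq_add_of_le hm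
    rw [show n + (k + 1) + j = n + (k + 1 + j) by ring] at this ⊢
    rwa [show anchor μ Q b (2 * ε) (n + (k + 1 + j)) y = a (k + 1) from
      hconst _ (Nat.le_add_right _ _)] at this
  have h2 : ‖(avg (Q n y)) - avg (a 0)‖ₑ ≤ 2 * ε :=
    (enorm_average_sub_le (h.measure_ne_zero _ _) (h.measure_ne_top _ _) (hb _ _) _).trans
      (average_anchor_le (b := b) hle hosc n y)
  calc ‖b y - avg (Q n y)‖ₑ
      = ‖(b y - avg (a (k + 1))) + (avg (a (k + 1)) - avg (a 0)) +
          (avg (a 0) - avg (Q n y))‖ₑ := by congr 1; ring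
    _ ≤ 2 * ε + D * (2 * ε) * N + 2 * ε := by
        refine (enorm_add_le _ _).trans (add_le_add ((enorm_add_le _ _).trans
          (add_le_add h1 (hsumN _))) ?_)
        rw [enorm_sub_rev]
        exact h2
    _ = _ := by ring

/-- Domination of the commutator form of a family of cells by compositions of averaging operators,
those of the given family and of the selected cells. -/
theorem tsum_average_mul_lintegral_le [BorelSpace X] [μ.OuterRegular] [SFinite μ]
    (h : NestedPartitions μ D Q) (hbm : Measurable b)
    (hb : ∀ n x, IntegrableOn b (Q n x) μ) {ε : ℝ≥0∞} (hD : D ≠ 0) (hε0 : ε ≠ 0) (hε : ε ≠ ∞)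
    (hosc : ∀ n x, ⨍⁻ y in Q n x, ‖b y - ⨍ z in Q n x, b z ∂μ‖ₑ ∂μ ≤ ε)
    {ι : Type*} [Countable ι] {S : ι → Set X} (hS : ∀ i, ∃ n x, S i = Q n x)
    {u v : X → ℝ≥0∞} (hv : Measurable v) :
    ∑' i, (⨍⁻ y in S i, u y ∂μ) * ∫⁻ y in S i, ‖b y - ⨍ z in S i, b z ∂μ‖ₑ * v y ∂μ ≤
      ∫⁻ x, averagingOp μ S u x * (4 * ε * averagingOp μ S v x + 2 * D * ε *
        averagingOp μ (fun T : anchorFamily μ Q b (2 * ε) => (T : Set X)) v x) ∂μ := by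
  have hSm : ∀ i, MeasurableSet (S i) := fun i => by
    obtain ⟨n, x, hi⟩ := hS i
    rw [hi]; exact h.measurableSet n x
  have : Countable (anchorFamily μ Q b (2 * ε)) :=
    (h.countable_of_forall fun S hS => exists_eq_of_mem_anchorFamily hS).to_subtype
  have hTm : ∀ T : anchorFamily μ Q b (2 * ε), MeasurableSet (T : Set X) := fun T => by
    obtain ⟨n, x, hi⟩ := exists_eq_of_mem_anchorFamily T.2
    rw [hi]; exact h.measurableSet n x
  have m1 := measurable_averagingOp (μ := μ) hSm v
  have m2 := measurable_averagingOp (μ := μ) hTm v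
  rw [lintegral_averagingOp_mul hSm u (by fun_prop)]
  refine ENNReal.tsum_le_tsum fun i => ?_
  refine mul_le_mul_right ?_ _
  obtain ⟨n, x, hi⟩ := hS i
  set P := S i with hP
  have hPm : MeasurableSet P := hSm i
  set N : X → ℝ≥0∞ := fun y => ∑' T : {T : anchorFamily μ Q b (2 * ε) // (T : Set X) ⊆ P},
    (T : Set X).indicator (fun _ => 1) y with hN
  have hNm : Measurable N := Measurable.tsum fun T => measurable_const.indicator (hTm T)
  have hNv : Measurable fun y => N y * v y := hNm.mul hv
  have hbound : ∀ᵐ y ∂μ.restrict P, ‖b y - ⨍ z in P, b z ∂μ‖ₑ * v y ≤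
      4 * ε * v y + 2 * D * ε * (N y * v y) := by
    rw [ae_restrict_iff' hPm]
    filter_upwards [h.ae_enorm_sub_average_le hbm hb hD hε0 hε hosc] with y hy hyP
    have := hy n
    rw [h.eq_of_mem n x y (by rwa [hi] at hyP), ← hi] at this
    refine (mul_le_mul_left this _).trans_eq ?_
    simp only [hN]
    ring
  refine (lintegral_mono_ae hbound).trans ?_
  rw [lintegral_add_left (hv.const_mul _), lintegral_const_mul _ hv,
    lintegral_const_mul _ hNv, lintegral_add_left (m1.const_mul _),
    lintegral_const_mul _ m1, lintegral_const_mul _ m2]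
  have hav : ∀ {T : Set X}, (∃ n x, T = Q n x) → ∫⁻ y in T, v y ∂μ =
      (⨍⁻ y in T, v y ∂μ) * μ T := by
    rintro _ ⟨n, x, rfl⟩
    rw [setLAverage_eq, ENNReal.div_mul_cancel (h.measure_ne_zero _ _) (h.measure_ne_top _ _)]
  refine add_le_add (mul_le_mul_right ?_ _) (mul_le_mul_right ?_ _)
  · rw [hav ⟨n, x, hi⟩, ← setLIntegral_const]
    refine setLIntegral_mono' hPm fun y hy => ?_
    refine le_trans ?_ (ENNReal.le_tsum i)
    rw [Set.indicator_of_mem hy]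
  · calc ∫⁻ y in P, N y * v y ∂μ
        = ∑' T : {T : anchorFamily μ Q b (2 * ε) // (T : Set X) ⊆ P},
            ∫⁻ y in P, (T : Set X).indicator (fun _ => 1) y * v y ∂μ := by
          simp only [hN, ← ENNReal.tsum_mul_right]
          exact lintegral_tsum fun T =>
            ((measurable_const.indicator (hTm T)).mul hv).aemeasurable
      _ = ∑' T : {T : anchorFamily μ Q b (2 * ε) // (T : Set X) ⊆ P},
            ∫⁻ y in P, (T : Set X).indicator (fun _ => ⨍⁻ z in (T : Set X), v z ∂μ) y ∂μ := by
          refine tsum_congr fun T => ?_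
          have e : ∀ y, (T : Set X).indicator (fun _ => (1 : ℝ≥0∞)) y * v y =
              (T : Set X).indicator v y := fun y => by
            by_cases hy : y ∈ (T : Set X) <;> simp [hy]
          simp only [e]
          rw [lintegral_indicator (hTm T), lintegral_indicator (hTm T),
            Measure.restrict_restrict (hTm T), Set.inter_eq_left.2 T.2, setLIntegral_const]
          exact hav (exists_eq_of_mem_anchorFamily T.1.2)
      _ = ∫⁻ y in P, ∑' T : {T : anchorFamily μ Q b (2 * ε) // (T : Set X) ⊆ P},
            (T : Set X).indicator (fun _ => ⨍⁻ z in (T : Set X), v z ∂μ) y ∂μ :=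
          (lintegral_tsum fun T : {T : anchorFamily μ Q b (2 * ε) // (T : Set X) ⊆ P} =>
            (measurable_const.indicator (hTm T)).aemeasurable).symm
      _ ≤ _ := lintegral_mono fun y => ENNReal.tsum_comp_le_tsum_of_injective
          Subtype.val_injective (fun T : anchorFamily μ Q b (2 * ε) =>
            (T : Set X).indicator (fun _ => ⨍⁻ z in (T : Set X), v z ∂μ) y)

theorem tsum_average_mul_lintegral_le_weightedNorm [BorelSpace X] [μ.OuterRegular] [SFinite μ]
    (h : NestedPartitions μ D Q) (hbm : Measurable b)
    (hb : ∀ n x, IntegrableOn b (Q n x) μ) {ε : ℝ≥0∞} (hD : D ≠ 0) (hε0 : ε ≠ 0) (hε : ε ≠ ∞)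
    (hosc : ∀ n x, ⨍⁻ y in Q n x, ‖b y - ⨍ z in Q n x, b z ∂μ‖ₑ ∂μ ≤ ε)
    {ι : Type*} [Countable ι] {S : ι → Set X} (hS : ∀ i, ∃ n x, S i = Q n x)
    {p q : ℝ} {W V : X → ℝ≥0∞} (hWV : DualWeights μ p q W V) {M : ℝ≥0∞}
    {u v : X → ℝ≥0∞} (hv : Measurable v)
    (huS : weightedNorm μ p W (averagingOp μ S u) ≤ M * weightedNorm μ p W u)
    (hvS : weightedNorm μ q V (averagingOp μ S v) ≤ M * weightedNorm μ q V v)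
    (hvT : weightedNorm μ q V
      (averagingOp μ (fun T : anchorFamily μ Q b (2 * ε) => (T : Set X)) v) ≤
        M * weightedNorm μ q V v) :
    ∑' i, (⨍⁻ y in S i, u y ∂μ) * ∫⁻ y in S i, ‖b y - ⨍ z in S i, b z ∂μ‖ₑ * v y ∂μ ≤
      (4 + 2 * D) * ε * M ^ 2 * weightedNorm μ p W u * weightedNorm μ q V v := by
  have hSm : ∀ i, MeasurableSet (S i) := fun i => by
    obtain ⟨n, x, hi⟩ := hS i
    rw [hi]; exact h.measurableSet n x
  have : Countable (anchorFamily μ Q b (2 * ε)) :=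
    (h.countable_of_forall fun S hS => exists_eq_of_mem_anchorFamily hS).to_subtype
  have hTm : ∀ T : anchorFamily μ Q b (2 * ε), MeasurableSet (T : Set X) := fun T => by
    obtain ⟨n, x, hi⟩ := exists_eq_of_mem_anchorFamily T.2
    rw [hi]; exact h.measurableSet n x
  have m0 := measurable_averagingOp (μ := μ) hSm u
  have m1 := measurable_averagingOp (μ := μ) hSm v
  have m2 := measurable_averagingOp (μ := μ) hTm v
  refine (h.tsum_average_mul_lintegral_le hbm hb hD hε0 hε hosc hS hv).trans ?_
  have e : ∀ x, averagingOp μ S u x * (4 * ε * averagingOp μ S v x + 2 * D * ε *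
      averagingOp μ (fun T : anchorFamily μ Q b (2 * ε) => (T : Set X)) v x) =
      4 * ε * (averagingOp μ S u x * averagingOp μ S v x) + 2 * D * ε * (averagingOp μ S u x *
      averagingOp μ (fun T : anchorFamily μ Q b (2 * ε) => (T : Set X)) v x) := fun x => by ring
  simp only [e]
  rw [lintegral_add_left (by fun_prop), lintegral_const_mul _ (by fun_prop),
    lintegral_const_mul _ (by fun_prop)]
  calc _ ≤ 4 * ε * ((M * weightedNorm μ p W u) * (M * weightedNorm μ q V v)) +
        2 * D * ε * ((M * weightedNorm μ p W u) * (M * weightedNorm μ q V v)) := by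
        gcongr
        · exact (hWV.lintegral_mul_le m0 m1).trans (mul_le_mul' huS hvS)
        · exact (hWV.lintegral_mul_le m0 m2).trans (mul_le_mul' huS hvT)
    _ = _ := by ring

end Anchor

end NestedPartitions

end Oscillation

/-! ### The geometry of the Kolmogorov group -/

namespace KolmogorovMatrix

variable (K : KolmogorovMatrix)

theorem F_zero : K.F 0 = 1 := by simp [F]

theorem F_add (s t : ℝ) : K.F (s + t) = K.F s * K.F t := by
  rw [F, F, F, ← Matrix.exp_add_of_commute]
  · rw [neg_add, add_smul]
  · exact ((Commute.refl _).smul_left _).smul_right _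

theorem continuous_F : Continuous K.F := by
  open scoped Matrix.Norms.Operator in
  have h := NormedSpace.exp_continuous
    (𝔸 := Matrix (Σ k : Fin (K.d + 1), Fin (K.s k)) (Σ k : Fin (K.d + 1), Fin (K.s k)) ℝ)
  exact h.comp (by fun_prop : Continuous fun t : ℝ => -t • K.B.transpose)

theorem continuous_comp : Continuous fun zw : K.Space × K.Space => K.comp zw.1 zw.2 := by
  have := K.continuous_F
  unfold comp
  refine Continuous.prodMk ?_ (by fun_prop)
  exact (by fun_prop : Continuous fun zw : K.Space × K.Space => zw.2.1).add
    (Continuous.matrix_mulVec (by fun_prop) (by fun_prop))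

theorem continuous_inv : Continuous K.inv := by
  have := K.continuous_F
  unfold inv
  refine Continuous.prodMk ?_ (by fun_prop)
  have h : Continuous fun z : K.Space => (K.F (-z.2)).mulVec z.1 :=
    Continuous.matrix_mulVec (by fun_prop) (by fun_prop)
  exact h.neg

theorem comp_assoc (z w u : K.Space) : K.comp (K.comp z w) u = K.comp z (K.comp w u) := by
  ext1
  · simp only [comp, F_add, Matrix.mulVec_add, Matrix.mulVec_mulVec, add_assoc]
    rw [← F_add, ← F_add, add_comm u.2 w.2]
  · simp only [comp, add_assoc]

theorem comp_zero (z : K.Space) : K.comp z 0 = z := by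
  ext1 <;> simp [comp, F_zero]

theorem zero_comp (z : K.Space) : K.comp 0 z = z := by
  ext1 <;> simp [comp]

theorem inv_zero : K.inv 0 = 0 := by
  ext1 <;> simp [inv]

theorem inv_comp (z : K.Space) : K.comp (K.inv z) z = 0 := by
  ext1
  · simp [comp, inv, Matrix.mulVec_neg, ← F_add, F_zero]
  · simp [comp, inv]

theorem comp_inv (z : K.Space) : K.comp z (K.inv z) = 0 := by
  ext1
  · simp [comp, inv]
  · simp [comp, inv]

theorem inv_comp_comp (z w : K.Space) : K.comp (K.inv z) (K.comp z w) = w := by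
  rw [← comp_assoc, inv_comp, zero_comp]

theorem comp_inv_comp (z w : K.Space) : K.comp z (K.comp (K.inv z) w) = w := by
  rw [← comp_assoc, comp_inv, zero_comp]

theorem inv_comp_comp_comp (z v w : K.Space) :
    K.comp (K.inv (K.comp z v)) (K.comp z w) = K.comp (K.inv v) w := by
  have h : K.comp (K.comp z v) (K.comp (K.inv (K.comp z v)) (K.comp z w)) =
      K.comp (K.comp z v) (K.comp (K.inv v) w) := by
    rw [comp_inv_comp, comp_assoc, comp_inv_comp]
  have := congrArg (K.comp (K.inv (K.comp z v))) h
  rwa [inv_comp_comp, inv_comp_comp] at this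

theorem qdist_comp (z v w : K.Space) : K.qdist (K.comp z v) (K.comp z w) = K.qdist v w := by
  rw [qdist, qdist, inv_comp_comp_comp, inv_comp_comp_comp]

/-- Left translation by `z`. -/
def translation (z : K.Space) : K.Space ≃ᵐ K.Space where
  toFun := K.comp z
  invFun := K.comp (K.inv z)
  left_inv := K.inv_comp_comp z
  right_inv := K.comp_inv_comp z
  measurable_toFun := (K.continuous_comp.comp (Continuous.prodMk_right z)).measurable
  measurable_invFun := (K.continuous_comp.comp (Continuous.prodMk_right (K.inv z))).measurable

theorem measurePreserving_translation (z : K.Space) :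
    MeasurePreserving (K.translation z) volume volume := by
  have hF : Measurable fun t : ℝ => (K.F t).mulVec z.1 :=
    (Continuous.matrix_mulVec K.continuous_F continuous_const).measurable
  -- A shear over the translation of the time variable.
  have h1 : MeasurePreserving (fun w : ℝ × ((Σ k : Fin (K.d + 1), Fin (K.s k)) → ℝ) =>
      (z.2 + w.1, w.2 + (K.F w.1).mulVec z.1)) (volume.prod volume) (volume.prod volume) :=
    (measurePreserving_add_left volume z.2).skew_product
      (g := fun t x => x + (K.F t).mulVec z.1)
      (measurable_snd.add (hF.comp measurable_fst))
      (ae_of_all _ fun t => (measurePreserving_add_right volume _).map_eq)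
  exact (Measure.measurePreserving_swap.comp h1).comp Measure.measurePreserving_swap

theorem volume_ball_eq_zero_center (z : K.Space) (r : ℝ) :
    volume (K.ball z r) = volume (K.ball 0 r) := by
  rw [← (K.measurePreserving_translation z).measure_preimage_equiv (K.ball z r)]
  congr 1
  ext w
  change K.qdist z (K.comp z w) < r ↔ K.qdist 0 w < r
  rw [← K.qdist_comp z 0 w, comp_zero]

/-- The dilation `(x, t) ↦ (r^{a_i} x_i, r² t)`. -/
def dilation (r : ℝ) : K.Space →ₗ[ℝ] K.Space :=
  LinearMap.prodMap
    (Matrix.toLin' (Matrix.diagonal fun i : Σ k : Fin (K.d + 1), Fin (K.s k) =>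
      r ^ (2 * (i.1 : ℕ) + 1)))
    (r ^ 2 • LinearMap.id)

theorem dilation_apply_fst (r : ℝ) (z : K.Space) :
    (K.dilation r z).1 = (Matrix.diagonal fun i : Σ k : Fin (K.d + 1), Fin (K.s k) =>
      r ^ (2 * (i.1 : ℕ) + 1)).mulVec z.1 := by
  simp [dilation]

theorem dilation_apply_snd (r : ℝ) (z : K.Space) : (K.dilation r z).2 = r ^ 2 * z.2 := by
  simp [dilation]

/-- The homogeneous dimension of `ℝ^{N+1}`. -/
def homDim : ℕ := ∑ i : Σ k : Fin (K.d + 1), Fin (K.s k), (2 * (i.1 : ℕ) + 1) + 2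

theorem det_dilation (r : ℝ) : LinearMap.det (K.dilation r) = r ^ K.homDim := by
  rw [dilation, LinearMap.det_prodMap, LinearMap.det_toLin', Matrix.det_diagonal,
    Finset.prod_pow_eq_pow_sum, homDim, pow_add]
  simp

/-- As `B` has nonzero blocks only directly above the diagonal, the dilation by `r` conjugates `t Bᵀ`
into `r² t Bᵀ`; so dilations are automorphisms of the group. -/
theorem F_mul_diagonal {r : ℝ} (hr : 0 < r) (t : ℝ) :
    K.F (r ^ 2 * t) * (Matrix.diagonal fun i : Σ k : Fin (K.d + 1), Fin (K.s k) =>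
      r ^ (2 * (i.1 : ℕ) + 1)) =
    (Matrix.diagonal fun i : Σ k : Fin (K.d + 1), Fin (K.s k) =>
      r ^ (2 * (i.1 : ℕ) + 1)) * K.F t := by
  set Δ := Matrix.diagonal fun i : Σ k : Fin (K.d + 1), Fin (K.s k) => r ^ (2 * (i.1 : ℕ) + 1)
    with hΔ
  have hU : IsUnit Δ := by
    rw [Matrix.isUnit_iff_isUnit_det, hΔ, Matrix.det_diagonal]
    exact (Finset.prod_pos fun i _ => pow_pos hr _).ne'.isUnit
  have hB : Δ * (-t • K.B.transpose) = (-(r ^ 2 * t) • K.B.transpose) * Δ := by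
    ext i j
    rw [hΔ, Matrix.diagonal_mul, Matrix.mul_diagonal]
    simp only [Matrix.smul_apply, Matrix.transpose_apply, smul_eq_mul]
    by_cases hij : (i.1 : ℕ) = j.1 + 1
    · rw [hij]; ring
    · rw [K.B_eq_zero j i hij]; ring
  have hB' : Δ * (-t • K.B.transpose) * Δ⁻¹ = -(r ^ 2 * t) • K.B.transpose := by
    rw [hB, Matrix.mul_assoc, Matrix.mul_nonsing_inv _ ((Matrix.isUnit_iff_isUnit_det _).1 hU),
      Matrix.mul_one]
  have := Matrix.exp_conj Δ (-t • K.B.transpose) hU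
  rw [hB'] at this
  rw [F, F, this, Matrix.mul_assoc,
    Matrix.nonsing_inv_mul _ ((Matrix.isUnit_iff_isUnit_det _).1 hU), Matrix.mul_one]

theorem inv_dilation {r : ℝ} (hr : 0 < r) (z : K.Space) :
    K.inv (K.dilation r z) = K.dilation r (K.inv z) := by
  ext1
  · rw [dilation_apply_fst]
    simp only [inv, dilation_apply_fst, dilation_apply_snd]
    rw [Matrix.mulVec_neg, Matrix.mulVec_mulVec, Matrix.mulVec_mulVec, ← mul_neg,
      F_mul_diagonal _ hr]
  · rw [dilation_apply_snd]
    simp [inv, dilation_apply_snd]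

/-- The function of `ρ` whose value is `1` at `ρ = ‖z‖`. -/
def normSum (z : K.Space) (ρ : ℝ) : ℝ :=
  ∑ i, z.1 i ^ 2 / ρ ^ (2 * (2 * (i.1 : ℕ) + 1)) + z.2 ^ 2 / ρ ^ 4

theorem normSum_dilation {r : ℝ} (hr : 0 < r) (z : K.Space) (ρ : ℝ) :
    K.normSum (K.dilation r z) (r * ρ) = K.normSum z ρ := by
  rw [normSum, normSum, dilation_apply_fst, dilation_apply_snd]
  congr 1
  · refine Finset.sum_congr rfl fun i _ => ?_
    rw [Matrix.mulVec_diagonal, mul_pow, mul_pow, ← pow_mul, mul_comm (2 * (i.1 : ℕ) + 1) 2]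
    exact mul_div_mul_left _ _ (pow_pos hr _).ne'
  · rw [mul_pow, mul_pow, ← pow_mul]
    exact mul_div_mul_left _ _ (pow_pos hr _).ne'

theorem homNorm_dilation {r : ℝ} (hr : 0 < r) (z : K.Space) :
    K.homNorm (K.dilation r z) = r * K.homNorm z := by
  open scoped Pointwise in
  have : {ρ : ℝ | 0 < ρ ∧ K.normSum (K.dilation r z) ρ = 1} =
      r • {ρ : ℝ | 0 < ρ ∧ K.normSum z ρ = 1} := by
    ext ρ
    rw [Set.mem_smul_set]
    constructor
    · rintro ⟨h0, h1⟩
      have e : r * (ρ / r) = ρ := mul_div_cancel₀ _ hr.ne'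
      refine ⟨ρ / r, ⟨by positivity, ?_⟩, e⟩
      rw [← K.normSum_dilation hr, e, h1]
    · rintro ⟨σ, ⟨h0, h1⟩, rfl⟩
      refine ⟨by simp only [smul_eq_mul]; positivity, ?_⟩
      rw [smul_eq_mul, K.normSum_dilation hr, h1]
  change sInf {ρ : ℝ | 0 < ρ ∧ K.normSum (K.dilation r z) ρ = 1} = r * _
  rw [this, Real.sInf_smul_of_nonneg hr.le]
  rfl

theorem homNorm_nonneg (z : K.Space) : 0 ≤ K.homNorm z :=
  Real.sInf_nonneg fun _ h => h.1.le

theorem qdist_zero (w : K.Space) : K.qdist 0 w = K.homNorm (K.inv w) + K.homNorm w := by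
  rw [qdist, comp_zero, inv_zero, zero_comp]

instance isAddHaarMeasure_volume : (volume : Measure K.Space).IsAddHaarMeasure :=
  inferInstanceAs (((volume : Measure ((Σ k : Fin (K.d + 1), Fin (K.s k)) → ℝ)).prod
    (volume : Measure ℝ)).IsAddHaarMeasure)

theorem volume_ball_zero {r : ℝ} (hr : 0 < r) :
    volume (K.ball 0 r) = ENNReal.ofReal (r ^ K.homDim) * volume (K.ball 0 1) := by
  have hpre : K.dilation r ⁻¹' K.ball 0 r = K.ball 0 1 := by
    ext w
    change K.qdist 0 (K.dilation r w) < r ↔ K.qdist 0 w < 1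
    rw [qdist_zero, qdist_zero, K.inv_dilation hr, K.homNorm_dilation hr, K.homNorm_dilation hr,
      ← mul_add, mul_lt_iff_lt_one_right hr]
  have hdet : LinearMap.det (K.dilation r) ≠ 0 := by
    rw [det_dilation]; exact (pow_pos hr _).ne'
  have := Measure.addHaar_preimage_linearMap (volume : Measure K.Space) hdet (K.ball 0 r)
  rw [hpre, det_dilation, abs_of_pos (by positivity)] at this
  rw [this, ← mul_assoc, ← ENNReal.ofReal_mul (by positivity), mul_inv_cancel₀ (pow_pos hr _).ne',
    ENNReal.ofReal_one, one_mul]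

theorem exists_normSum_eq_one {z : K.Space} (hz : z ≠ 0) {r : ℝ} (hr : 0 < r)
    (h : K.normSum z r ≤ 1) : ∃ ρ, 0 < ρ ∧ ρ ≤ r ∧ K.normSum z ρ = 1 := by
  have hnn : ∀ ρ : ℝ, 0 < ρ → ∀ i : Σ k : Fin (K.d + 1), Fin (K.s k),
      0 ≤ z.1 i ^ 2 / ρ ^ (2 * (2 * (i.1 : ℕ) + 1)) := fun ρ hρ i => by positivity
  -- Near `0` the sum is at least `1`, because of any nonzero coordinate of `z`.
  have hone : ∀ c : ℝ, c ≠ 0 → ∀ ρ : ℝ, 0 < ρ → ρ ≤ 1 → ρ ≤ |c| → ∀ n, 1 ≤ n →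
      1 ≤ c ^ 2 / ρ ^ (2 * n) := by
    intro c hc ρ hρ h1 h2 n hn
    rw [one_le_div (by positivity)]
    calc ρ ^ (2 * n) ≤ ρ ^ 2 := pow_le_pow_of_le_one hρ.le h1 (by omega)
      _ ≤ |c| ^ 2 := by gcongr
      _ = c ^ 2 := sq_abs c
  obtain ⟨ρ₀, h0, h0r, h01⟩ : ∃ ρ₀, 0 < ρ₀ ∧ ρ₀ ≤ r ∧ 1 ≤ K.normSum z ρ₀ := by
    by_cases hx : z.1 = 0
    · have ht : z.2 ≠ 0 := fun ht => hz (Prod.ext hx ht)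
      have hpos : 0 < min r (min 1 |z.2|) := by positivity
      refine ⟨_, hpos, min_le_left _ _, ?_⟩
      refine (hone z.2 ht _ hpos ?_ ?_ 2 one_le_two).trans ?_
      · exact (min_le_right _ _).trans (min_le_left _ _)
      · exact (min_le_right _ _).trans (min_le_right _ _)
      · exact le_add_of_nonneg_left (Finset.sum_nonneg fun i _ => hnn _ hpos i)
    · obtain ⟨i, hi⟩ := Function.ne_iff.1 hx
      have hi : z.1 i ≠ 0 := hi
      have hpos : 0 < min r (min 1 |z.1 i|) := by positivity
      refine ⟨_, hpos, min_le_left _ _, ?_⟩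
      refine (hone (z.1 i) hi _ hpos ?_ ?_ (2 * (i.1 : ℕ) + 1) (by omega)).trans ?_
      · exact (min_le_right _ _).trans (min_le_left _ _)
      · exact (min_le_right _ _).trans (min_le_right _ _)
      · exact (Finset.single_le_sum (fun i _ => hnn _ hpos i) (Finset.mem_univ i)).trans
          (le_add_of_nonneg_right (by positivity))
  have hcont : ContinuousOn (K.normSum z) (Set.Icc ρ₀ r) := by
    unfold normSum
    refine ContinuousOn.add (continuousOn_finsetSum _ fun i _ => ?_) ?_ <;>
      refine ContinuousOn.div continuousOn_const (by fun_prop) fun x hx => ?_ <;>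
      exact pow_ne_zero _ (h0.trans_le hx.1).ne'
  obtain ⟨ρ, hρ, he⟩ := intermediate_value_Icc' h0r hcont ⟨h, h01⟩
  exact ⟨ρ, h0.trans_le hρ.1, hρ.2, he⟩

theorem exists_normSum_le_one (z : K.Space) : ∃ r, 0 < r ∧ K.normSum z r ≤ 1 := by
  set A := ∑ i, z.1 i ^ 2 + z.2 ^ 2 with hA
  have hA0 : 0 ≤ A := by positivity
  refine ⟨1 + A, by positivity, ?_⟩
  have hle : K.normSum z (1 + A) ≤ A / (1 + A) ^ 2 := by
    rw [normSum, hA, add_div, Finset.sum_div, ← hA]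
    have h1 : (1 : ℝ) ≤ 1 + A := by linarith
    gcongr with i
    · omega
    · norm_num
  refine hle.trans ?_
  rw [div_le_one (by positivity)]
  nlinarith

theorem homNorm_le_of_normSum_le_one {z : K.Space} {r : ℝ} (hr : 0 < r) (h : K.normSum z r ≤ 1) :
    K.homNorm z ≤ r := by
  by_cases hz : z = 0
  · subst hz
    have : {ρ : ℝ | 0 < ρ ∧ K.normSum 0 ρ = 1} = ∅ := by
      ext ρ; simp [normSum]
    change sInf {ρ : ℝ | 0 < ρ ∧ K.normSum 0 ρ = 1} ≤ r
    rw [this, Real.sInf_empty]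
    exact hr.le
  · obtain ⟨ρ, h0, hρ, h1⟩ := K.exists_normSum_eq_one hz hr h
    exact (csInf_le (⟨0, fun _ h => h.1.le⟩ : BddBelow {ρ : ℝ | 0 < ρ ∧ K.normSum z ρ = 1})
      ⟨h0, h1⟩).trans hρ

/-- The homogeneous norm controls the Euclidean size near the origin. -/
theorem norm_le_of_homNorm_lt {z : K.Space} {r : ℝ} (hr1 : r ≤ 1) (h : K.homNorm z < r) :
    ‖z‖ ≤ r := by
  have hr0 : 0 ≤ r := (K.homNorm_nonneg z).trans h.le
  by_cases hz : z = 0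
  · rw [hz, norm_zero]; exact hr0
  obtain ⟨r₀, hr₀, hr₀1⟩ := K.exists_normSum_le_one z
  obtain ⟨ρ₀, h1, _, h2⟩ := K.exists_normSum_eq_one hz hr₀ hr₀1
  obtain ⟨ρ, ⟨hρ0, hρ⟩, hρr⟩ := exists_lt_of_csInf_lt
    (⟨ρ₀, h1, h2⟩ : {ρ : ℝ | 0 < ρ ∧ K.normSum z ρ = 1}.Nonempty) h
  have hρ1 : ρ ≤ 1 := hρr.le.trans hr1
  have hnn : ∀ i : Σ k : Fin (K.d + 1), Fin (K.s k),
      0 ≤ z.1 i ^ 2 / ρ ^ (2 * (2 * (i.1 : ℕ) + 1)) := fun i => by positivity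
  have hone : ∀ c : ℝ, ∀ n, 1 ≤ n → c ^ 2 / ρ ^ (2 * n) ≤ 1 → |c| ≤ r := by
    intro c n hn hc
    rw [div_le_one (by positivity), mul_comm, pow_mul] at hc
    exact (abs_le_of_sq_le_sq hc (by positivity)).trans
      ((pow_le_of_le_one hρ0.le hρ1 (by omega)).trans hρr.le)
  rw [Prod.norm_def, max_le_iff]
  constructor
  · refine (pi_norm_le_iff_of_nonneg hr0).2 fun i => ?_
    refine hone _ (2 * (i.1 : ℕ) + 1) (by omega) (le_trans ?_ hρ.le)
    exact (Finset.single_le_sum (fun i _ => hnn i) (Finset.mem_univ i)).trans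
      (le_add_of_nonneg_right (by positivity))
  · refine hone _ 2 one_le_two (le_trans ?_ hρ.le)
    exact le_add_of_nonneg_left (Finset.sum_nonneg fun i _ => hnn i)

theorem homNorm_lt_of_mem_ball {z w : K.Space} {r : ℝ} (h : w ∈ K.ball z r) :
    K.homNorm (K.comp (K.inv w) z) < r ∧ K.homNorm (K.comp (K.inv z) w) < r := by
  have h : K.homNorm (K.comp (K.inv w) z) + K.homNorm (K.comp (K.inv z) w) < r := h
  have h1 := K.homNorm_nonneg (K.comp (K.inv w) z)
  have h2 := K.homNorm_nonneg (K.comp (K.inv z) w)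
  constructor <;> linarith

/-- Small balls containing a point of an open set lie in the open set. -/
theorem exists_ball_subset {O : Set K.Space} (hO : IsOpen O) {x : K.Space} (hx : x ∈ O) :
    ∃ r, 0 < r ∧ ∀ z r', r' ≤ r → x ∈ K.ball z r' → K.ball z r' ⊆ O := by
  have hc : Continuous fun uv : K.Space × K.Space => K.comp x (K.comp uv.1 uv.2) :=
    K.continuous_comp.comp (continuous_const.prodMk K.continuous_comp)
  have h0 : (fun uv : K.Space × K.Space => K.comp x (K.comp uv.1 uv.2)) ⁻¹' O ∈
      nhds (0 : K.Space × K.Space) := by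
    refine (hO.preimage hc).mem_nhds ?_
    change K.comp x (K.comp 0 0) ∈ O
    rwa [comp_zero, comp_zero]
  obtain ⟨ε, hε, hsub⟩ := Metric.mem_nhds_iff.1 h0
  refine ⟨min 1 (ε / 2), by positivity, fun z r' hr' hxz w hw => ?_⟩
  have hr1 : r' ≤ 1 := hr'.trans (min_le_left _ _)
  have hr2 : r' < ε := (hr'.trans (min_le_right _ _)).trans_lt (half_lt_self hε)
  have h1 := K.norm_le_of_homNorm_lt hr1 (K.homNorm_lt_of_mem_ball hxz).1
  have h2 := K.norm_le_of_homNorm_lt hr1 (K.homNorm_lt_of_mem_ball hw).2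
  have : (K.comp (K.inv x) z, K.comp (K.inv z) w) ∈ Metric.ball (0 : K.Space × K.Space) ε := by
    rw [mem_ball_zero_iff, Prod.norm_def]
    exact max_lt (h1.trans_lt hr2) (h2.trans_lt hr2)
  have := hsub this
  change K.comp x (K.comp (K.comp (K.inv x) z) (K.comp (K.inv z) w)) ∈ O at this
  rwa [comp_assoc, comp_inv_comp, comp_inv_comp] at this

theorem volume_ball_one_ne_top : volume (K.ball 0 1) ≠ ∞ := by
  have : K.ball 0 1 ⊆ Metric.closedBall 0 1 := fun w hw => by
    rw [mem_closedBall_zero_iff]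
    have := (K.homNorm_lt_of_mem_ball hw).2
    rw [inv_zero, zero_comp] at this
    exact K.norm_le_of_homNorm_lt le_rfl this
  exact ((measure_mono this).trans_lt measure_closedBall_lt_top).ne

theorem volume_ball_one_ne_zero : volume (K.ball 0 1) ≠ 0 := by
  have hc : Continuous fun z : K.Space => K.normSum z (1 / 4) := by
    unfold normSum; fun_prop
  have h1 : ∀ᶠ z in nhds (0 : K.Space), K.homNorm z ≤ 1 / 4 := by
    have : ∀ᶠ z in nhds (0 : K.Space), K.normSum z (1 / 4) < 1 :=
      hc.tendsto 0 |>.eventually_lt_const (by simp [normSum])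
    exact this.mono fun z hz => K.homNorm_le_of_normSum_le_one (by norm_num) hz.le
  have h2 : ∀ᶠ z in nhds (0 : K.Space), K.homNorm (K.inv z) ≤ 1 / 4 := by
    have := K.continuous_inv.tendsto 0
    rw [inv_zero] at this
    exact this.eventually h1
  have : K.ball 0 1 ∈ nhds (0 : K.Space) := by
    filter_upwards [h1, h2] with z hz1 hz2
    change K.qdist 0 z < 1
    rw [qdist_zero]
    linarith
  exact (Measure.measure_pos_of_mem_nhds _ this).ne'

theorem volume_ball (z : K.Space) {r : ℝ} (hr : 0 < r) :
    volume (K.ball z r) = ENNReal.ofReal (r ^ K.homDim) * volume (K.ball 0 1) := by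
  rw [volume_ball_eq_zero_center, K.volume_ball_zero hr]

theorem volume_ball_ne_top (z : K.Space) {r : ℝ} (hr : 0 < r) : volume (K.ball z r) ≠ ∞ := by
  rw [K.volume_ball z hr]
  exact ENNReal.mul_ne_top ENNReal.ofReal_ne_top K.volume_ball_one_ne_top

theorem volume_ball_ne_zero (z : K.Space) {r : ℝ} (hr : 0 < r) : volume (K.ball z r) ≠ 0 := by
  rw [K.volume_ball z hr]
  exact mul_ne_zero (by rw [ne_eq, ENNReal.ofReal_eq_zero, not_le]; positivity)
    K.volume_ball_one_ne_zero

/-- The homogeneous dimension is bounded in terms of `N` alone: the block sizes decrease, so at most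
`N` blocks are nonempty. -/
theorem homDim_le : K.homDim ≤ 2 * K.N * K.N + 2 := by
  have hi : ∀ i : Σ k : Fin (K.d + 1), Fin (K.s k), 2 * (i.1 : ℕ) + 1 ≤ 2 * K.N := by
    rintro ⟨k, a⟩
    have hk : 1 ≤ K.s k := by have := a.2; omega
    have : (k : ℕ) + 1 ≤ K.N := by
      calc (k : ℕ) + 1 = ∑ j ∈ Finset.Iic k, 1 := by simp
        _ ≤ ∑ j ∈ Finset.Iic k, K.s j :=
          Finset.sum_le_sum fun j hj => hk.trans (K.s_antitone (Finset.mem_Iic.1 hj))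
        _ ≤ K.N := Finset.sum_le_sum_of_subset (Finset.subset_univ _)
    simp only
    omega
  have hcard : Fintype.card (Σ k : Fin (K.d + 1), Fin (K.s k)) = K.N := by
    simp [N]
  rw [homDim]
  refine Nat.add_le_add_right ?_ 2
  calc _ ≤ ∑ _i : Σ k : Fin (K.d + 1), Fin (K.s k), 2 * K.N := Finset.sum_le_sum fun i _ => hi i
    _ = 2 * K.N * K.N := by rw [Finset.sum_const, Finset.card_univ, hcard, smul_eq_mul, mul_comm]

/-- Doubling: the ratio of the measures of two balls is bounded by a power of the ratio of their
radii, with an exponent depending on `N` only. -/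
theorem volume_ball_le (z w : K.Space) {r c : ℝ} (hr : 0 < r) (hc : 1 ≤ c) :
    volume (K.ball z (c * r)) ≤
      ENNReal.ofReal (c ^ (2 * K.N * K.N + 2)) * volume (K.ball w r) := by
  rw [K.volume_ball z (by positivity), K.volume_ball w hr, ← mul_assoc,
    ← ENNReal.ofReal_mul (by positivity), mul_pow]
  gcongr
  exact K.homDim_le

end KolmogorovMatrix

/-! ### Dyadic grids of ultraparabolic cubes -/

namespace KolmogorovMatrix

variable {K : KolmogorovMatrix} {c₁ C₁ θ : ℝ}

/-- A bound, depending on `N` and `c` only, for the ratio of the measures of two balls with ratio of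
radii `c`. -/
def ballRatio (N : ℕ) (c : ℝ) : ℝ≥0∞ := ENNReal.ofReal (c ^ (2 * N * N + 2))

theorem ballRatio_ne_top (N : ℕ) (c : ℝ) : ballRatio N c ≠ ∞ := ENNReal.ofReal_ne_top

theorem ballRatio_ne_zero (N : ℕ) {c : ℝ} (hc : 0 < c) : ballRatio N c ≠ 0 := by
  rw [ballRatio, ne_eq, ENNReal.ofReal_eq_zero, not_le]
  positivity

/-- The constant in the weighted bound for the commutators of `η`-sparse operators. -/
def commConst (N : ℕ) (p q η c₁ C₁ θ : ℝ) : ℝ≥0∞ :=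
  (4 + 2 * ballRatio N (C₁ / (c₁ * θ))) * (2 * ballRatio N (C₁ / c₁)) *
    (weightedSparseConst p q η + weightedSparseConst p q (1 / 2)) ^ 2

theorem commConst_ne_top (N : ℕ) {p : ℝ} (hp : 1 < p) (η c₁ C₁ θ : ℝ) :
    commConst N p (p / (p - 1)) η c₁ C₁ θ ≠ ∞ := by
  refine ENNReal.mul_ne_top (ENNReal.mul_ne_top (ENNReal.add_ne_top.2 ⟨by simp, ?_⟩) ?_)
    (ENNReal.pow_ne_top (ENNReal.add_ne_top.2
      ⟨weightedSparseConst_ne_top hp _, weightedSparseConst_ne_top hp _⟩))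
  · exact ENNReal.mul_ne_top (by simp) (ballRatio_ne_top _ _)
  · exact ENNReal.mul_ne_top (by simp) (ballRatio_ne_top _ _)

namespace DyadicGrid

variable (U : K.DyadicGrid c₁ C₁ θ)

theorem cube_eq_of_mem {k : ℤ} {α β : U.Idx k} {x : K.Space} (hα : x ∈ U.cube k α)
    (hβ : x ∈ U.cube k β) : U.cube k α = U.cube k β := by
  refine Set.Subset.antisymm ?_ ?_
  · exact (U.nested k k le_rfl β α).resolve_right (Set.not_disjoint_iff.2 ⟨x, hα, hβ⟩)
  · exact (U.nested k k le_rfl α β).resolve_right (Set.not_disjoint_iff.2 ⟨x, hβ, hα⟩)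

theorem exists_mem_cube (k : ℤ) (x : K.Space) : ∃ α, x ∈ U.cube k α := by
  have := U.cover k ▸ Set.mem_univ x
  exact Set.mem_iUnion.1 this

/-- The cube of generation `k₀ + n` containing `x`. -/
def cell (k₀ : ℤ) (n : ℕ) (x : K.Space) : Set K.Space :=
  U.cube (k₀ + n) (U.exists_mem_cube (k₀ + n) x).choose

theorem mem_cell (k₀ : ℤ) (n : ℕ) (x : K.Space) : x ∈ U.cell k₀ n x :=
  (U.exists_mem_cube (k₀ + n) x).choose_spec

theorem volume_cube_ne_zero (hc₁ : 0 < c₁) (hθ : 0 < θ) (k : ℤ) (α : U.Idx k) :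
    volume (U.cube k α) ≠ 0 := fun h =>
  K.volume_ball_ne_zero (U.center k α) (show 0 < c₁ * θ ^ k by positivity)
    (measure_mono_null (U.ball_subset k α) h)

theorem volume_cube_ne_top (hC₁ : 0 < C₁) (hθ : 0 < θ) (k : ℤ) (α : U.Idx k) :
    volume (U.cube k α) ≠ ∞ :=
  ((measure_mono (U.subset_ball k α)).trans_lt
    (K.volume_ball_ne_top (U.center k α) (show 0 < C₁ * θ ^ k by positivity)).lt_top).ne

theorem volume_ball_le_volume_cube (hc₁ : 0 < c₁) (hle : c₁ ≤ C₁) (hθ : 0 < θ) (k : ℤ)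
    (α : U.Idx k) : volume (K.ball (U.center k α) (C₁ * θ ^ k)) ≤
      ballRatio K.N (C₁ / c₁) * volume (U.cube k α) := by
  have e : C₁ * θ ^ k = C₁ / c₁ * (c₁ * θ ^ k) := by field_simp
  rw [e]
  refine (K.volume_ball_le _ (U.center k α) (by positivity) ((one_le_div hc₁).2 hle)).trans ?_
  exact mul_le_mul_right (measure_mono (U.ball_subset k α)) _

theorem volume_cube_le (hc₁ : 0 < c₁) (hle : c₁ ≤ C₁) (hθ : 0 < θ) (hθ₁ : θ < 1) (k : ℤ)
    (α : U.Idx k) (β : U.Idx (k + 1)) :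
    volume (U.cube k α) ≤ ballRatio K.N (C₁ / (c₁ * θ)) * volume (U.cube (k + 1) β) := by
  have e : C₁ * θ ^ k = C₁ / (c₁ * θ) * (c₁ * θ ^ (k + 1)) := by
    rw [zpow_add_one₀ hθ.ne']; field_simp
  refine (measure_mono (U.subset_ball k α)).trans ?_
  rw [e]
  refine (K.volume_ball_le _ (U.center (k + 1) β) (by positivity) ?_).trans ?_
  · rw [one_le_div (by positivity)]
    nlinarith
  · exact mul_le_mul_right (measure_mono (U.ball_subset (k + 1) β)) _

theorem nestedPartitions (hc₁ : 0 < c₁) (hle : c₁ ≤ C₁) (hθ : 0 < θ) (hθ₁ : θ < 1) (k₀ : ℤ) :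
    NestedPartitions volume (ballRatio K.N (C₁ / (c₁ * θ))) (U.cell k₀) where
  mem := U.mem_cell k₀
  eq_of_mem n _ _ hy := U.cube_eq_of_mem (U.mem_cell k₀ n _) hy
  succ_subset n x := by
    refine (U.nested _ _ (by push_cast; omega) _ _).resolve_right
      (Set.not_disjoint_iff.2 ⟨x, U.mem_cell k₀ (n + 1) x, U.mem_cell k₀ n x⟩)
  measurableSet n x := U.measurableSet_cube _ _
  countable n := by
    have := U.countable_idx (k₀ + n)
    refine (Set.countable_range (U.cube (k₀ + n))).mono ?_
    rintro _ ⟨x, rfl⟩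
    exact ⟨_, rfl⟩
  measure_ne_zero n x := U.volume_cube_ne_zero hc₁ hθ _ _
  measure_ne_top n x := U.volume_cube_ne_top (hc₁.trans_le hle) hθ _ _
  measure_le n x := by
    obtain ⟨β, hβ⟩ := U.exists_mem_cube (k₀ + n + 1) x
    have h1 : U.cell k₀ (n + 1) x = U.cube (k₀ + n + 1) β := by
      have : ∀ (m : ℤ), m = k₀ + n + 1 → ∀ α : U.Idx m, x ∈ U.cube m α →
          U.cube m α = U.cube (k₀ + n + 1) β := by
        rintro _ rfl α hα
        exact U.cube_eq_of_mem hα hβ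
      exact this _ (by push_cast; ring) _ (U.mem_cell k₀ (n + 1) x)
    rw [h1]
    exact U.volume_cube_le hc₁ hle hθ hθ₁ _ _ β
  exists_subset O hO x hx := by
    obtain ⟨r, hr, hsub⟩ := K.exists_ball_subset hO hx
    have hlim : Filter.Tendsto (fun n : ℕ => C₁ * θ ^ k₀ * θ ^ n) Filter.atTop (nhds 0) := by
      simpa using (tendsto_pow_atTop_nhds_zero_of_lt_one hθ.le hθ₁).const_mul (C₁ * θ ^ k₀)
    obtain ⟨n, hn⟩ := (hlim.eventually_lt_const hr).exists
    have hn : C₁ * θ ^ (k₀ + n : ℤ) ≤ r := by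
      rw [zpow_add₀ hθ.ne', zpow_natCast, ← mul_assoc]; exact hn.le
    exact ⟨n, (U.subset_ball _ _).trans (hsub _ _ hn (U.subset_ball _ _ (U.mem_cell k₀ n x)))⟩

theorem exists_isSparseFamily (hc₁ : 0 < c₁) (hle : c₁ ≤ C₁) (hθ : 0 < θ) {η : ℝ}
    {G : Set U.Cube} (hG : U.IsSparse η G) :
    ∃ F : G → Set K.Space, IsSparseFamily volume η (fun P : G => U.pts P) F := by
  obtain ⟨F, hF, hd⟩ := hG
  refine ⟨fun P => F P, ?_, fun P => U.measurableSet_cube _ _,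
    fun P => U.volume_cube_ne_zero hc₁ hθ _ _,
    fun P => U.volume_cube_ne_top (hc₁.trans_le hle) hθ _ _,
    fun P => (hF P P.2).1, fun P => (hF P P.2).2.1, fun P R hPR => ?_, fun P => (hF P P.2).2.2⟩
  · intro P R
    rcases le_total P.1.1 R.1.1 with h | h
    · rcases U.nested _ _ h P.1.2 R.1.2 with h1 | h1
      · exact Or.inr (Or.inl h1)
      · exact Or.inr (Or.inr h1.symm)
    · rcases U.nested _ _ h R.1.2 P.1.2 with h1 | h1
      · exact Or.inl h1
      · exact Or.inr (Or.inr h1)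
  · exact hd P.2 R.2 (Subtype.coe_injective.ne hPR)

instance countable_cube : Countable U.Cube :=
  have := U.countable_idx
  inferInstance

/-- The mean oscillation of a function of small mean oscillation over a cube is bounded by that over
the ball attached to it. -/
theorem average_enorm_sub_average_le (hc₁ : 0 < c₁) (hle : c₁ ≤ C₁) (hθ : 0 < θ) {δ 𝔎 : ℝ}
    {b : K.Space → ℝ} (hb : K.IsSmallBMO δ 𝔎 b) {k : ℤ} (α : U.Idx k)
    (hbi : IntegrableOn b (U.cube k α)) (hk : C₁ * θ ^ k < 𝔎) :
    ⨍⁻ x in U.cube k α, ‖b x - ⨍ y in U.cube k α, b y‖ₑ ∂volume ≤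
      2 * (ballRatio K.N (C₁ / c₁) * ENNReal.ofReal δ) := by
  have hC₁ : 0 < C₁ := hc₁.trans_le hle
  have h0 := U.volume_cube_ne_zero hc₁ hθ k α
  have ht := U.volume_cube_ne_top hC₁ hθ k α
  have hr : 0 < C₁ * θ ^ k := by positivity
  set P := U.cube k α with hP
  set B := K.ball (U.center k α) (C₁ * θ ^ k) with hB
  set c := ⨍ y in B, b y with hc
  have h1 : ⨍⁻ x in B, ‖b x - c‖ₑ ∂volume ≤ ENNReal.ofReal δ := by
    have h := hb.2.le
    simp only [iSup_le_iff] at h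
    exact h (U.center k α) (C₁ * θ ^ k) hr hk
  have h2 : ⨍⁻ x in P, ‖b x - c‖ₑ ∂volume ≤ ballRatio K.N (C₁ / c₁) * ENNReal.ofReal δ := by
    rw [setLAverage_eq, ENNReal.div_le_iff (K.volume_ball_ne_zero _ hr)
      (K.volume_ball_ne_top _ hr)] at h1
    rw [setLAverage_eq, ENNReal.div_le_iff h0 ht]
    calc ∫⁻ x in P, ‖b x - c‖ₑ ≤ ∫⁻ x in B, ‖b x - c‖ₑ := lintegral_mono_set (U.subset_ball k α)
      _ ≤ ENNReal.ofReal δ * (ballRatio K.N (C₁ / c₁) * volume P) :=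
        h1.trans (mul_le_mul_right (U.volume_ball_le_volume_cube hc₁ hle hθ k α) _)
      _ = _ := by ring
  have h3 : ∀ x, ‖b x - ⨍ y in P, b y‖ₑ ≤ ‖b x - c‖ₑ + ‖(⨍ y in P, b y) - c‖ₑ := fun x => by
    have : b x - ⨍ y in P, b y = (b x - c) - ((⨍ y in P, b y) - c) := by ring
    rw [this]
    exact enorm_sub_le
  calc ⨍⁻ x in P, ‖b x - ⨍ y in P, b y‖ₑ ∂volume
      ≤ ⨍⁻ x in P, (‖b x - c‖ₑ + ‖(⨍ y in P, b y) - c‖ₑ) ∂volume := lintegral_mono h3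
    _ = (⨍⁻ x in P, ‖b x - c‖ₑ ∂volume) + ‖(⨍ y in P, b y) - c‖ₑ := by
        rw [setLAverage_eq, setLAverage_eq, lintegral_add_right _ measurable_const,
          setLIntegral_const, ENNReal.add_div, ENNReal.mul_div_cancel_right h0 ht]
    _ ≤ (⨍⁻ x in P, ‖b x - c‖ₑ ∂volume) + ⨍⁻ x in P, ‖b x - c‖ₑ ∂volume :=
        add_le_add le_rfl (enorm_average_sub_le h0 ht hbi c)
    _ ≤ _ := by rw [← two_mul]; gcongr

/-- The bound for the bilinear form of the commutators. It suffices to consider finite subfamilies;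
the smallest generation in such a subfamily is the first of the nested partitions to which the
stopping-time construction applies. -/
theorem tsum_average_mul_lintegral_le (hc₁ : 0 < c₁) (hle : c₁ ≤ C₁) (hθ : 0 < θ) (hθ₁ : θ < 1)
    {η : ℝ} (hη : 0 < η) {G : Set U.Cube} (hG : U.IsSparse η G) {p q : ℝ}
    {W V : K.Space → ℝ≥0∞} (hWV : DualWeights volume p q W V) {A : ℝ≥0∞} (hA : A ≠ ∞)
    (hap : ∀ k α, (⨍⁻ x in U.cube k α, W x ∂volume) *
      (⨍⁻ x in U.cube k α, V x ∂volume) ^ (p - 1) ≤ A)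
    {δ 𝔎 : ℝ} (hδ : 0 < δ) (hr : ∀ P ∈ G, U.radius P < 𝔎) {b : K.Space → ℝ} (hbm : Measurable b)
    (hbi : ∀ k α, IntegrableOn b (U.cube k α)) (hb : K.IsSmallBMO δ 𝔎 b)
    {u v : K.Space → ℝ≥0∞} (hu : Measurable u) (hv : Measurable v) :
    (∑' P : G, (⨍⁻ y in U.pts P, u y ∂volume) *
        ∫⁻ y in U.pts P, ‖b y - ⨍ z in U.pts P, b z‖ₑ * v y) ≤
      commConst K.N p q η c₁ C₁ θ * ENNReal.ofReal δ * A ^ (2 * max (1 / (p - 1)) 1) *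
        weightedNorm volume p W u * weightedNorm volume q V v ∧
    (∑' P : G, (⨍⁻ y in U.pts P, v y ∂volume) *
        ∫⁻ y in U.pts P, ‖b y - ⨍ z in U.pts P, b z‖ₑ * u y) ≤
      commConst K.N p q η c₁ C₁ θ * ENNReal.ofReal δ * A ^ (2 * max (1 / (p - 1)) 1) *
        weightedNorm volume q V v * weightedNorm volume p W u := by
  obtain ⟨F, hF⟩ := U.exists_isSparseFamily hc₁ hle hθ hG
  have hC₁ : 0 < C₁ := hc₁.trans_le hle
  set ε : ℝ≥0∞ := 2 * (ballRatio K.N (C₁ / c₁) * ENNReal.ofReal δ) with hε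
  have hε0 : ε ≠ 0 := mul_ne_zero two_ne_zero
    (mul_ne_zero (ballRatio_ne_zero _ (by positivity)) (by simpa using hδ))
  have hεt : ε ≠ ∞ := ENNReal.mul_ne_top (by simp)
    (ENNReal.mul_ne_top (ballRatio_ne_top _ _) ENNReal.ofReal_ne_top)
  have hD0 : ballRatio K.N (C₁ / (c₁ * θ)) ≠ 0 := ballRatio_ne_zero _ (by positivity)
  set M : ℝ≥0∞ := (weightedSparseConst p q η + weightedSparseConst p q (1 / 2)) *
    A ^ max (1 / (p - 1)) 1 with hM
  have hconst : (4 + 2 * ballRatio K.N (C₁ / (c₁ * θ))) * ε * M ^ 2 =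
      commConst K.N p q η c₁ C₁ θ * ENNReal.ofReal δ * A ^ (2 * max (1 / (p - 1)) 1) := by
    rw [hM, mul_pow, ← ENNReal.rpow_natCast (A ^ _), ← ENNReal.rpow_mul, commConst, hε,
      mul_comm 2 (max _ _)]
    push_cast
    ring
  rw [← hconst]
  have key : ∀ s : Finset G,
      (∑' P : s, (⨍⁻ y in U.pts P, u y ∂volume) *
        ∫⁻ y in U.pts P, ‖b y - ⨍ z in U.pts P, b z‖ₑ * v y) ≤
      (4 + 2 * ballRatio K.N (C₁ / (c₁ * θ))) * ε * M ^ 2 *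
        weightedNorm volume p W u * weightedNorm volume q V v ∧
      (∑' P : s, (⨍⁻ y in U.pts P, v y ∂volume) *
        ∫⁻ y in U.pts P, ‖b y - ⨍ z in U.pts P, b z‖ₑ * u y) ≤
      (4 + 2 * ballRatio K.N (C₁ / (c₁ * θ))) * ε * M ^ 2 *
        weightedNorm volume q V v * weightedNorm volume p W u := by
    intro s
    rcases s.eq_empty_or_nonempty with rfl | hs
    · simp
    obtain ⟨P₀, hP₀, hmin⟩ := s.exists_min_image (fun P : G => P.1.1) hs
    set k₀ : ℤ := P₀.1.1 with hk₀
    have hQ := U.nestedPartitions hc₁ hle hθ hθ₁ k₀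
    have hosc : ∀ n x, ⨍⁻ y in U.cell k₀ n x, ‖b y - ⨍ z in U.cell k₀ n x, b z‖ₑ ∂volume ≤ ε := by
      intro n x
      refine U.average_enorm_sub_average_le hc₁ hle hθ hb _ (hbi _ _) ?_
      refine lt_of_le_of_lt ?_ (hr P₀ P₀.2)
      refine mul_le_mul_of_nonneg_left ?_ hC₁.le
      exact zpow_le_zpow_right_of_le_one₀ hθ hθ₁.le (by omega)
    have hcell : ∀ P : s, ∃ n x, U.pts P = U.cell k₀ n x := by
      rintro ⟨⟨⟨k, α⟩, hPG⟩, hPs⟩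
      have hk : k₀ ≤ k := hmin _ hPs
      obtain ⟨n, rfl⟩ : ∃ n : ℕ, k = k₀ + n := ⟨(k - k₀).toNat, by omega⟩
      obtain ⟨x, hx⟩ := nonempty_of_measure_ne_zero (U.volume_cube_ne_zero hc₁ hθ _ α)
      exact ⟨n, x, U.cube_eq_of_mem hx (U.mem_cell k₀ n x)⟩
    have hsF := hF.comp_injective (φ := fun P : s => (P : G)) Subtype.coe_injective
    have hT := hQ.isSparseFamily_anchorFamily hε0 hεt hosc
    have : Countable (anchorFamily volume (U.cell k₀) b (2 * ε)) :=
      (hQ.countable_of_forall fun S hS => exists_eq_of_mem_anchorFamily hS).to_subtype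
    have hapT : ∀ T : anchorFamily volume (U.cell k₀) b (2 * ε),
        (⨍⁻ x in (T : Set K.Space), W x ∂volume) *
          (⨍⁻ x in (T : Set K.Space), V x ∂volume) ^ (p - 1) ≤ A := by
      intro T
      obtain ⟨n, x, hT⟩ := exists_eq_of_mem_anchorFamily T.2
      rw [hT]
      exact hap _ _
    have hapS : ∀ P : s, (⨍⁻ x in U.pts P, W x ∂volume) *
        (⨍⁻ x in U.pts P, V x ∂volume) ^ (p - 1) ≤ A := fun P => hap _ _
    have hMη : weightedSparseConst p q η * A ^ max (1 / (p - 1)) 1 ≤ M := by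
      rw [hM]; gcongr; exact le_self_add
    have hMT : weightedSparseConst p q (1 / 2) * A ^ max (1 / (p - 1)) 1 ≤ M := by
      rw [hM]; gcongr; exact le_add_self
    have buS := (hsF.weightedNorm_averagingOp_le hWV hη hA hapS hu).trans
      (mul_le_mul_left hMη _)
    have buT := (hT.weightedNorm_averagingOp_le hWV one_half_pos hA hapT hu).trans
      (mul_le_mul_left hMT _)
    have bvS := (hsF.weightedNorm_averagingOp_le_dual hWV hη hA hapS hv).trans
      (mul_le_mul_left hMη _)
    have bvT := (hT.weightedNorm_averagingOp_le_dual hWV one_half_pos hA hapT hv).trans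
      (mul_le_mul_left hMT _)
    have hbQ : ∀ n x, IntegrableOn b (U.cell k₀ n x) := fun n x => hbi _ _
    exact ⟨hQ.tsum_average_mul_lintegral_le_weightedNorm hbm hbQ hD0 hε0 hεt hosc hcell hWV hv
        buS bvS bvT,
      hQ.tsum_average_mul_lintegral_le_weightedNorm hbm hbQ hD0 hε0 hεt hosc hcell hWV.symm hu
        bvS buS buT⟩
  constructor
  · rw [ENNReal.tsum_eq_iSup_sum]
    refine iSup_le fun s => ?_
    have := (key s).1
    rwa [tsum_fintype, Finset.sum_coe_sort s (fun P : G => (⨍⁻ y in U.pts P, u y ∂volume) *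
        ∫⁻ y in U.pts P, ‖b y - ⨍ z in U.pts P, b z‖ₑ * v y)] at this
  · rw [ENNReal.tsum_eq_iSup_sum]
    refine iSup_le fun s => ?_
    have := (key s).2
    rwa [tsum_fintype, Finset.sum_coe_sort s (fun P : G => (⨍⁻ y in U.pts P, v y ∂volume) *
        ∫⁻ y in U.pts P, ‖b y - ⨍ z in U.pts P, b z‖ₑ * u y)] at this

end DyadicGrid

end KolmogorovMatrix

/-! ### Weighted bounds on the Kolmogorov group -/

namespace KolmogorovMatrix

variable {K : KolmogorovMatrix} {c₁ C₁ θ p : ℝ}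

theorem eLpNorm_weighted {E : Type*} [ENorm E] (hp : 0 < p) {ω : K.Space → ℝ} (hω : Measurable ω)
    {g : K.Space → E} (hg : AEMeasurable (fun x => ‖g x‖ₑ) volume) :
    eLpNorm g (ENNReal.ofReal p) (K.weighted ω) =
      weightedNorm volume p (fun x => ENNReal.ofReal (ω x)) (fun x => ‖g x‖ₑ) := by
  rw [eLpNorm_eq_lintegral_rpow_enorm_toReal (by simpa using hp) ENNReal.ofReal_ne_top,
    ENNReal.toReal_ofReal hp.le, weighted, weightedNorm,
    lintegral_withDensity_eq_lintegral_mul₀ (by fun_prop) (hg.pow_const p)]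
  congr 1
  exact lintegral_congr fun x => mul_comm _ _

theorem weighted_congr {ω ω' : K.Space → ℝ} (h : ω =ᵐ[volume] ω') :
    K.weighted ω = K.weighted ω' :=
  withDensity_congr_ae (h.mono fun x hx => by simp only [hx])

theorem apChar_congr {ω ω' : K.Space → ℝ} (h : ω =ᵐ[volume] ω') :
    K.apChar c₁ C₁ θ p ω = K.apChar c₁ C₁ θ p ω' := by
  refine iSup_congr fun P => iSup_congr fun _ => ?_
  congr 1
  · exact laverage_congr (ae_restrict_of_ae (h.mono fun x hx => by simp only [hx]))
  · congr 1
    exact laverage_congr (ae_restrict_of_ae (h.mono fun x hx => by simp only [hx]))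

theorem IsApWeight.congr {ω ω' : K.Space → ℝ} (hω : K.IsApWeight c₁ C₁ θ p ω)
    (h : ω =ᵐ[volume] ω') : K.IsApWeight c₁ C₁ θ p ω' where
  locallyIntegrable x := by
    obtain ⟨s, hs, hi⟩ := hω.locallyIntegrable x
    exact ⟨s, hs, hi.congr (ae_restrict_of_ae h)⟩
  pos := by filter_upwards [hω.pos, h] with x hx he; rwa [← he]
  apChar_lt_top := by rw [← apChar_congr h]; exact hω.apChar_lt_top

theorem IsSmallBMO.congr {δ 𝔎 : ℝ} {b b' : K.Space → ℝ} (hb : K.IsSmallBMO δ 𝔎 b)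
    (h : b =ᵐ[volume] b') : K.IsSmallBMO δ 𝔎 b' := by
  refine ⟨fun x => ?_, lt_of_eq_of_lt ?_ hb.2⟩
  · obtain ⟨s, hs, hi⟩ := hb.1 x
    exact ⟨s, hs, hi.congr (ae_restrict_of_ae h)⟩
  · refine iSup_congr fun z => iSup_congr fun ρ => iSup_congr fun _ => iSup_congr fun _ => ?_
    rw [average_congr (ae_restrict_of_ae h)]
    exact laverage_congr (ae_restrict_of_ae (h.mono fun x hx => by simp only [hx]))

theorem IsApWeight.dualWeights (hp : 1 < p) {ω : K.Space → ℝ} (hω : K.IsApWeight c₁ C₁ θ p ω)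
    (hm : Measurable ω) :
    DualWeights volume p (p / (p - 1)) (fun x => ENNReal.ofReal (ω x))
      (fun x => ENNReal.ofReal (ω x) ^ (1 - p / (p - 1))) where
  conj := Real.HolderConjugate.conjExponent hp
  measurable_left := by fun_prop
  measurable_right := by fun_prop
  ae := by
    filter_upwards [hω.pos] with x hx
    exact ⟨by simpa using hx, ENNReal.ofReal_ne_top, rfl⟩

theorem IsApWeight.volume_absolutelyContinuous {ω : K.Space → ℝ}
    (hω : K.IsApWeight c₁ C₁ θ p ω) : volume ≪ K.weighted ω :=
  withDensity_absolutelyContinuous'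
    hω.locallyIntegrable.aestronglyMeasurable.aemeasurable.ennreal_ofReal
    (hω.pos.mono fun x hx => by simpa using hx)

theorem weighted_absolutelyContinuous (ω : K.Space → ℝ) : K.weighted ω ≪ volume :=
  withDensity_absolutelyContinuous _ _

namespace DyadicGrid

variable (U : K.DyadicGrid c₁ C₁ θ)

theorem average_mul_average_rpow_le_apChar (ω : K.Space → ℝ) (k : ℤ) (α : U.Idx k) :
    (⨍⁻ x in U.cube k α, ENNReal.ofReal (ω x) ∂volume) *
      (⨍⁻ x in U.cube k α, ENNReal.ofReal (ω x) ^ (1 - p / (p - 1)) ∂volume) ^ (p - 1) ≤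
    K.apChar c₁ C₁ θ p ω :=
  le_iSup₂_of_le (U.cube k α) ⟨U, k, α, rfl⟩ le_rfl

theorem sparseOp_congr (G : Set U.Cube) {f f' : K.Space → ℝ} (h : f =ᵐ[volume] f') :
    U.sparseOp G f = U.sparseOp G f' := by
  ext x
  refine tsum_congr fun P => ?_
  rw [laverage_congr (ae_restrict_of_ae (h.mono fun x hx => by rw [hx]))]

theorem sparseCommOp_congr (G : Set U.Cube) {b b' f f' : K.Space → ℝ} (hb : b =ᵐ[volume] b')
    (h : f =ᵐ[volume] f') : U.sparseCommOp G b f =ᵐ[volume] U.sparseCommOp G b' f' := by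
  filter_upwards [hb] with x hx
  refine tsum_congr fun P => ?_
  simp only [Set.indicator, hx]
  rw [laverage_congr (ae_restrict_of_ae (h.mono fun x hx => by rw [hx])),
    average_congr (ae_restrict_of_ae hb)]

theorem sparseCommAdjOp_congr (G : Set U.Cube) {b b' f f' : K.Space → ℝ} (hb : b =ᵐ[volume] b')
    (h : f =ᵐ[volume] f') : U.sparseCommAdjOp G b f = U.sparseCommAdjOp G b' f' := by
  ext x
  refine tsum_congr fun P => ?_
  rw [average_congr (ae_restrict_of_ae hb), laverage_congr (ae_restrict_of_ae (by
    filter_upwards [h, hb] with x hx hx'; rw [hx, hx']))]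

/-- The bound for sparse operators. Weight and function enter through their classes modulo null sets
only, so they may be taken measurable. -/
theorem eLpNorm_sparseOp_le (hp : 1 < p) (hc₁ : 0 < c₁) (hle : c₁ ≤ C₁) (hθ : 0 < θ) {η : ℝ}
    (hη : 0 < η) {G : Set U.Cube} (hG : U.IsSparse η G) {ω : K.Space → ℝ}
    (hω : K.IsApWeight c₁ C₁ θ p ω) {f : K.Space → ℝ} (hf : AEMeasurable f volume) :
    eLpNorm (U.sparseOp G f) (ENNReal.ofReal p) (K.weighted ω) ≤
      weightedSparseConst p (p / (p - 1)) η * K.apChar c₁ C₁ θ p ω ^ max (1 / (p - 1)) 1 *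
        eLpNorm f (ENNReal.ofReal p) (K.weighted ω) := by
  have hω' := hω.locallyIntegrable.aestronglyMeasurable.aemeasurable
  wlog hm : Measurable ω generalizing ω
  · rw [weighted_congr hω'.ae_eq_mk, apChar_congr hω'.ae_eq_mk]
    exact this (hω.congr hω'.ae_eq_mk) hω'.measurable_mk.aemeasurable hω'.measurable_mk
  wlog hfm : Measurable f generalizing f
  · rw [U.sparseOp_congr G hf.ae_eq_mk,
      eLpNorm_congr_ae ((weighted_absolutelyContinuous ω).ae_le hf.ae_eq_mk)]
    exact this hf.measurable_mk.aemeasurable hf.measurable_mk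
  obtain ⟨F, hF⟩ := U.exists_isSparseFamily hc₁ hle hθ hG
  have hp0 : 0 < p := by linarith
  have hme : Measurable (U.sparseOp G f) :=
    measurable_averagingOp (fun P : G => U.measurableSet_cube _ _) _
  rw [eLpNorm_weighted hp0 hm (by simpa using hme.aemeasurable),
    eLpNorm_weighted hp0 hm (by fun_prop)]
  exact hF.weightedNorm_averagingOp_le (hω.dualWeights hp hm) hη hω.apChar_lt_top.ne
    (fun P => U.average_mul_average_rpow_le_apChar ω _ _) (by fun_prop)

/-- The bound for the commutators. Both forms are instances of the same sum, with the roles of the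
two dual functions exchanged. -/
theorem eLpNorm_sparseCommOp_add_le (hp : 1 < p) (hc₁ : 0 < c₁) (hle : c₁ ≤ C₁) (hθ : 0 < θ)
    (hθ₁ : θ < 1) {η : ℝ} (hη : 0 < η) {G : Set U.Cube} (hG : U.IsSparse η G) {ω : K.Space → ℝ}
    (hω : K.IsApWeight c₁ C₁ θ p ω) {δ 𝔎 : ℝ} (hδ : 0 < δ) (hr : ∀ P ∈ G, U.radius P < 𝔎)
    {b : K.Space → ℝ} (hb : MemLp b ∞ volume) (hbmo : K.IsSmallBMO δ 𝔎 b)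
    {f : K.Space → ℝ} (hf : AEMeasurable f volume) :
    eLpNorm (U.sparseCommOp G b f) (ENNReal.ofReal p) (K.weighted ω) +
        eLpNorm (U.sparseCommAdjOp G b f) (ENNReal.ofReal p) (K.weighted ω) ≤
      2 * commConst K.N p (p / (p - 1)) η c₁ C₁ θ *
        K.apChar c₁ C₁ θ p ω ^ (2 * max (1 / (p - 1)) 1) * ENNReal.ofReal δ *
          eLpNorm f (ENNReal.ofReal p) (K.weighted ω) := by
  have hω' := hω.locallyIntegrable.aestronglyMeasurable.aemeasurable
  wlog hm : Measurable ω generalizing ω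
  · rw [weighted_congr hω'.ae_eq_mk, apChar_congr hω'.ae_eq_mk]
    exact this (hω.congr hω'.ae_eq_mk) hω'.measurable_mk.aemeasurable hω'.measurable_mk
  have hac := weighted_absolutelyContinuous ω
  wlog hfm : Measurable f generalizing f
  · rw [eLpNorm_congr_ae (hac.ae_le (U.sparseCommOp_congr G (ae_eq_refl b) hf.ae_eq_mk)),
      U.sparseCommAdjOp_congr G (ae_eq_refl b) hf.ae_eq_mk,
      eLpNorm_congr_ae (hac.ae_le hf.ae_eq_mk)]
    exact this hf.measurable_mk.aemeasurable hf.measurable_mk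
  wlog hbm : Measurable b generalizing b
  · have hbe := hb.1.aemeasurable.ae_eq_mk
    rw [eLpNorm_congr_ae (hac.ae_le (U.sparseCommOp_congr G hbe (ae_eq_refl f))),
      U.sparseCommAdjOp_congr G hbe (ae_eq_refl f)]
    exact this (hb.ae_eq hbe) (hbmo.congr hbe) hb.1.aemeasurable.measurable_mk
  have hp0 : 0 < p := by linarith
  have hC₁ : 0 < C₁ := hc₁.trans_le hle
  have hWV := hω.dualWeights hp hm
  have hbi : ∀ k α, IntegrableOn b (U.cube k α) := fun k α => by
    have : IsFiniteMeasure (volume.restrict (U.cube k α)) :=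
      ⟨by simpa using (U.volume_cube_ne_top hC₁ hθ k α).lt_top⟩
    exact (hb.restrict _).integrable le_top
  set h : K.Space → ℝ≥0∞ := fun x => ‖f x‖ₑ with hh
  have hhm : Measurable h := by fun_prop
  have hSm : ∀ P : G, MeasurableSet (U.pts P) := fun P => U.measurableSet_cube _ _
  have hgm : ∀ P : G, Measurable fun x =>
      ‖b x - ⨍ y in U.pts P, b y‖ₑ * ⨍⁻ y in U.pts P, ‖f y‖ₑ ∂volume := fun P => by fun_prop
  have hme : Measurable (U.sparseCommOp G b f) :=
    Measurable.tsum fun P => (hgm P).indicator (hSm P)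
  have hme' : Measurable (U.sparseCommAdjOp G b f) :=
    Measurable.tsum fun P => measurable_const.indicator (hSm P)
  have key : ∀ {v : K.Space → ℝ≥0∞}, Measurable v → _ := fun {v} hv =>
    U.tsum_average_mul_lintegral_le hc₁ hle hθ hθ₁ hη hG hWV hω.apChar_lt_top.ne
      (U.average_mul_average_rpow_le_apChar ω) hδ hr hbm hbi hbmo hhm hv
  rw [eLpNorm_weighted hp0 hm (by simpa using hme.aemeasurable),
    eLpNorm_weighted hp0 hm (by simpa using hme'.aemeasurable),
    eLpNorm_weighted hp0 hm (by fun_prop)]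
  have h1 := hWV.weightedNorm_le_of_forall hme
    (M := commConst K.N p (p / (p - 1)) η c₁ C₁ θ * ENNReal.ofReal δ *
      K.apChar c₁ C₁ θ p ω ^ (2 * max (1 / (p - 1)) 1) *
        weightedNorm volume p (fun x => ENNReal.ofReal (ω x)) h) fun v hv => by
    refine le_trans (le_of_eq ?_) (key hv).1
    refine (lintegral_tsum_indicator_mul hSm hgm hv).trans (tsum_congr fun P => ?_)
    rw [← lintegral_const_mul _ (by fun_prop)]
    exact lintegral_congr fun x => by simp only [hh]; ring
  have h2 := hWV.weightedNorm_le_of_forall hme'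
    (M := commConst K.N p (p / (p - 1)) η c₁ C₁ θ * ENNReal.ofReal δ *
      K.apChar c₁ C₁ θ p ω ^ (2 * max (1 / (p - 1)) 1) *
        weightedNorm volume p (fun x => ENNReal.ofReal (ω x)) h) fun v hv => by
    rw [mul_right_comm]
    refine le_trans (le_of_eq ?_) (key hv).2
    refine (lintegral_tsum_indicator_mul hSm (fun _ => measurable_const) hv).trans
      (tsum_congr fun P => ?_)
    rw [lintegral_const_mul _ hv, setLAverage_eq, setLAverage_eq]
    simp only [ENNReal.div_eq_inv_mul, hh]
    ring
  simp only [enorm_eq_self]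
  refine (add_le_add h1 h2).trans (le_of_eq ?_)
  ring

end DyadicGrid

end KolmogorovMatrix

end

theorem mainTheorem9 (N : ℕ) (p η : ℝ) (hp : 1 < p) (hη₀ : 0 < η) (hη₁ : η < 1) :
    (∃ C : ℝ≥0, ∀ (K : KolmogorovMatrix), K.N = N →
      ∀ (c₁ C₁ θ : ℝ), 0 < c₁ → c₁ ≤ C₁ → 0 < θ → θ < 1 →
      ∀ (U : K.DyadicGrid c₁ C₁ θ) (G : Set U.Cube), U.IsSparse η G →
      ∀ ω : K.Space → ℝ, K.IsApWeight c₁ C₁ θ p ω →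
      ∀ f : K.Space → ℝ, MemLp f (ENNReal.ofReal p) (K.weighted ω) →
        eLpNorm (U.sparseOp G f) (ENNReal.ofReal p) (K.weighted ω) ≤
          C * K.apChar c₁ C₁ θ p ω ^ max (1 / (p - 1)) 1 *
            eLpNorm f (ENNReal.ofReal p) (K.weighted ω)) ∧
    (∀ (c₁ C₁ θ : ℝ), 0 < c₁ → c₁ ≤ C₁ → 0 < θ → θ < 1 →
      ∃ C : ℝ≥0, ∀ (K : KolmogorovMatrix), K.N = N →
      ∀ (U : K.DyadicGrid c₁ C₁ θ) (G : Set U.Cube), U.IsSparse η G →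
      ∀ ω : K.Space → ℝ, K.IsApWeight c₁ C₁ θ p ω →
      ∀ (δ 𝔎 : ℝ), 0 < δ → 0 < 𝔎 → (∀ P ∈ G, U.radius P < 𝔎) →
      ∀ b : K.Space → ℝ, MemLp b ∞ volume → K.IsSmallBMO δ 𝔎 b →
      ∀ f : K.Space → ℝ, MemLp f (ENNReal.ofReal p) (K.weighted ω) →
        eLpNorm (U.sparseCommOp G b f) (ENNReal.ofReal p) (K.weighted ω) +
            eLpNorm (U.sparseCommAdjOp G b f) (ENNReal.ofReal p) (K.weighted ω) ≤
          C * K.apChar c₁ C₁ θ p ω ^ (2 * max (1 / (p - 1)) 1) * ENNReal.ofReal δ *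
            eLpNorm f (ENNReal.ofReal p) (K.weighted ω)) := by
  refine ⟨⟨(weightedSparseConst p (p / (p - 1)) η).toNNReal, ?_⟩, ?_⟩
  · intro K _ c₁ C₁ θ hc₁ hle hθ _ U G hG ω hω f hf
    rw [ENNReal.coe_toNNReal (weightedSparseConst_ne_top hp η)]
    exact U.eLpNorm_sparseOp_le hp hc₁ hle hθ hη₀ hG hω
      (hf.1.aemeasurable.mono_ac hω.volume_absolutelyContinuous)
  · intro c₁ C₁ θ hc₁ hle hθ hθ₁
    refine ⟨(2 * KolmogorovMatrix.commConst N p (p / (p - 1)) η c₁ C₁ θ).toNNReal, ?_⟩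
    rintro K rfl U G hG ω hω δ 𝔎 hδ _ hr b hb hbmo f hf
    rw [ENNReal.coe_toNNReal (ENNReal.mul_ne_top (by simp)
      (KolmogorovMatrix.commConst_ne_top K.N hp η c₁ C₁ θ))]
    exact U.eLpNorm_sparseCommOp_add_le hp hc₁ hle hθ hθ₁ hη₀ hG hω hδ hr hb hbmo
      (hf.1.aemeasurable.mono_ac hω.volume_absolutelyContinuous)
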